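/- Let $d\ge 7$ be an integer, let $p\ge 3$ be an odd integer, and set $s_p=\frac d2-\frac2{p-1}$. For every real $l\neq 0$ there is a radial real-valued function $Z_l\in C^2(\mathbb{R}^d\setminus\{0\})$ solving $$\Delta Z_l+|Z_l|^{p-1}Z_l=0\quad\text{on }\mathbb{R}^d\setminus\{0\}$$ such that, writing $Z_l(r)$ for its value on the sphere $|x|=r$, $$r^{d-2}Z_l(r)=l+O\left(r^{\,d-p(d-2)}\right)\quad\text{as } r\to\infty .$$ Moreover $Z_l\notin L^{d(p-1)/2}(\mathbb{R}^d)$, and $Z_l\notin\dot H^{s_p}(\mathbb{R}^d)$. Here $\dot H^{s}(\mathbb{R}^d)$, $0\le s<d/2$, is the closure of the Schwartz functions under the norm $\|f\|_{\dot H^s}=\|D^sf\|_{L^2}$, where $D^s=(-\Delta)^{s/2}$ is the Fourier multiplier with symbol $|\xi|^s$; it is realized as the space of locally integrable functions that are limits, in the sense of distributions, of $\dot H^s$-Cauchy sequences of Schwartz functions. -/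

import Mathlib

open MeasureTheory Filter Topology Asymptotics
open scoped ENNReal FourierTransform SchwartzMap InnerProductSpace ContDiff

/-- The homogeneous Sobolev norm `‖D ^ s f‖_{L²}` of a Schwartz function `f` on `ℝ ^ d`, where
`D ^ s = (-Δ) ^ (s / 2)` is the Fourier multiplier with symbol `|ξ| ^ s`. The norm is computed on
the Fourier side (Plancherel); as Mathlib's Fourier transform has the kernel `exp (-2πi x·ξ)`, the
symbol reads `(2π|ξ|) ^ s` in its frequency variable. -/
noncomputable def homSobolevNorm (d : ℕ) (s : ℝ) (f : 𝓢(EuclideanSpace ℝ (Fin d), ℂ)) : ℝ≥0∞ :=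
  eLpNorm (fun ξ : EuclideanSpace ℝ (Fin d) => ((2 * Real.pi * ‖ξ‖) ^ s : ℝ) • 𝓕 f ξ) 2 volume

/-- The function `u` on `ℝ ^ d` belongs to the homogeneous Sobolev space `Ḣ ^ s(ℝ ^ d)`, the
closure of the Schwartz functions under `homSobolevNorm`, for `0 ≤ s < d / 2`. In this range
Cauchy sequences of Schwartz functions converge in the sense of distributions, to a locally
integrable function that determines the element of the completion; so `u` belongs to the space
iff it is the distributional limit of such a Cauchy sequence. -/
def MemHomSobolev (d : ℕ) (s : ℝ) (u : EuclideanSpace ℝ (Fin d) → ℂ) : Prop :=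
  LocallyIntegrable u volume ∧
  ∃ f : ℕ → 𝓢(EuclideanSpace ℝ (Fin d), ℂ),
    Tendsto (fun mn : ℕ × ℕ => homSobolevNorm d s (f mn.1 - f mn.2)) atTop (𝓝 0) ∧
    ∀ φ : EuclideanSpace ℝ (Fin d) → ℝ, ContDiff ℝ ∞ φ → HasCompactSupport φ →
      Tendsto (fun n => ∫ x, φ x • f n x) atTop (𝓝 (∫ x, φ x • u x))

/-!
A radial function `z` solves the equation iff `z'' + (d-1)/r z' + z ^ p = 0` (`p` is odd, so
`|z| ^ (p-1) z = z ^ p`).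

*Construction.* Put `k = d - 2`, `N = k p - d`, `u = 1 / r` and `z(r) = u ^ k W(u)`. The equation
with the condition `W(0) = l` at infinity becomes a Volterra equation for `W`, singular only in
appearance, whose forcing carries the factor `u ^ N`. With the power truncated to a Lipschitz
function it has a global solution by the contraction principle in a weighted sup norm
(`exists_volterra_solution`). The quantity `Q ^ 2 / 2 + u ^ N W ^ (p+1) / ((p+1) k ^ 2)`, where
`k u ^ (k-1) Q = (u ^ k W)'`, decreases in `u` as long as the truncation is inactive; this forces
`|W| ≤ |l|`, so that the truncation is never active (`exists_profile`). The bound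
`|W(u) - l| ≤ C u ^ N` is the required asymptotics.

*Singularity at the origin.* In the Emden-Fowler variables `v(τ) = r ^ a z(r)`, `a = 2 / (p-1)`,
`r = exp (-τ)`, the equation is autonomous and its energy is nondecreasing in `τ`, tends to `0` as
`τ → -∞`, and is somewhere positive (`exists_emdenEnergy_pos`). Hence it stays away from `0` as
`τ → ∞`, and therefore `v` cannot become small on windows of unit length, not even in the mean
(`not_tendsto_integral_window`): smallness of `v` and `v ^ p` in `L ^ 1` of a window makes both `v`
and `v'` small at a point of it, hence the energy small there.

*Lebesgue space.* For `q = d (p-1) / 2` one has `a q = d`, so `Z ∈ L ^ q` means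
`∫ |v| ^ q dτ < ∞`, and the means of `v` over windows would tend to zero.

*Sobolev space.* For `1 ≤ s < d / 2` a Schwartz function `f` has spherical means of `‖f‖` bounded by
`C r ^ (s - d/2) ‖f‖_{Ḣ ^ s}` (`exists_sphere_bound`): split `f` at the frequency `1 / r`, bound the
low part in `L ^ ∞`, and integrate the gradient of the high part along rays. The means of one fixed
Schwartz function are bounded, so along a Cauchy sequence they are `o(r ^ (s - d/2))` as `r → 0`,
up to an arbitrarily small multiple of `r ^ (s - d/2)`; testing against radial bumps passes this to
the limit, and a radial member of `Ḣ ^ s` satisfies `r ^ (d/2 - s) z(r) → 0`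
(`MemHomSobolev.tendsto_rpow_mul`). For `s = d/2 - a` this says `v(τ) → 0`, which is excluded.
-/

/-! ### A Volterra equation with polynomial weight -/

/-- The exponential weight dominates the kernel `φ ^ (N-1)`: `a ^ N` times the integrand is, up to
the factor `1 / (μ N)`, the derivative of `φ ↦ exp (μ (a φ) ^ N)`. -/
theorem pow_mul_integral_exp_le (N : ℕ) (hN : 1 ≤ N) {μ : ℝ} (hμ : 0 < μ) (a : ℝ) :
    a ^ N * ∫ φ in (0 : ℝ)..1, φ ^ (N - 1) * Real.exp (μ * (a * φ) ^ N) ≤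
      Real.exp (μ * a ^ N) / μ := by
  have key : ∫ φ in (0 : ℝ)..1, (a ^ N * φ ^ (N - 1)) * Real.exp (μ * (a * φ) ^ N) =
      Real.exp (μ * (a * 1) ^ N) / (μ * N) - Real.exp (μ * (a * 0) ^ N) / (μ * N) := by
    apply intervalIntegral.integral_eq_sub_of_hasDerivAt
      (f := fun φ => Real.exp (μ * (a * φ) ^ N) / (μ * N))
    · intro x _
      have h1 : HasDerivAt (fun x : ℝ => μ * (a * x) ^ N) (μ * (N * (a * x) ^ (N - 1) * (a * 1))) x :=
        (((hasDerivAt_id x).const_mul a).pow N).const_mul μ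
      have hN0 : (N : ℝ) ≠ 0 := by positivity
      refine (h1.exp.div_const (μ * N)).congr_deriv ?_
      obtain ⟨n, rfl⟩ : ∃ n, N = n + 1 := ⟨N - 1, by omega⟩
      field_simp
      simp only [Nat.add_sub_cancel]
      ring
    · apply Continuous.intervalIntegrable
      fun_prop
  have h2 : a ^ N * ∫ φ in (0 : ℝ)..1, φ ^ (N - 1) * Real.exp (μ * (a * φ) ^ N) =
      ∫ φ in (0 : ℝ)..1, (a ^ N * φ ^ (N - 1)) * Real.exp (μ * (a * φ) ^ N) := by
    rw [← intervalIntegral.integral_const_mul]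
    congr 1; ext; ring
  rw [h2, key, mul_one]
  have hN1 : (1 : ℝ) ≤ N := by exact_mod_cast hN
  have : Real.exp (μ * a ^ N) / (μ * N) ≤ Real.exp (μ * a ^ N) / μ := by
    gcongr
    nlinarith
  have h3 : 0 ≤ Real.exp (μ * (a * 0) ^ N) / (μ * N) := by positivity
  linarith

/-- Global solvability of `W(u) = l - u ^ N ∫₀¹ κ(φ) h(W(u φ)) dφ` for bounded Lipschitz `h`: the
right-hand side is a contraction for the norm `sup exp (-μ |u| ^ N) |W(u)|` with `μ` large. -/
theorem exists_volterra_solution (N : ℕ) (hN : 1 ≤ N) (κ h : ℝ → ℝ) (hκc : Continuous κ)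
    (hκ : ∀ φ ∈ Set.Icc (0 : ℝ) 1, |κ φ| ≤ φ ^ (N - 1)) (K : NNReal) (hK : LipschitzWith K h)
    (M : ℝ) (hM : ∀ w, |h w| ≤ M) (l : ℝ) :
    ∃ W : ℝ → ℝ, Continuous W ∧
      ∀ u, W u = l - u ^ N * ∫ φ in (0 : ℝ)..1, κ φ * h (W (u * φ)) := by
  set μ : ℝ := 2 * K + 1 with hμ_def
  have hμ : 0 < μ := by positivity
  set E : ℝ → ℝ := fun u => Real.exp (μ * |u| ^ N) with hE
  have hEc : Continuous E := by fun_prop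
  have hEpos : ∀ u, 0 < E u := fun u => Real.exp_pos _
  have hhc : Continuous h := hK.continuous
  have hM0 : 0 ≤ M := (abs_nonneg _).trans (hM 0)
  -- the integral operator, conjugated by the weight `E`
  set J : (ℝ → ℝ) → ℝ → ℝ := fun w u => ∫ φ in (0 : ℝ)..1, κ φ * h (w (u * φ)) with hJ
  have hJc : ∀ w : ℝ → ℝ, Continuous w → Continuous (J w) := by
    intro w hw
    apply intervalIntegral.continuous_parametric_intervalIntegral_of_continuous'
    fun_prop
  have hκ1 : ∀ φ ∈ Set.Icc (0 : ℝ) 1, |κ φ| ≤ 1 := fun φ hφ =>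
    (hκ φ hφ).trans (pow_le_one₀ hφ.1 hφ.2)
  have hJb : ∀ w : ℝ → ℝ, ∀ u, |J w u| ≤ M := by
    intro w u
    have := intervalIntegral.norm_integral_le_of_norm_le_const (a := (0 : ℝ)) (b := 1) (C := M)
      (f := fun φ => κ φ * h (w (u * φ))) (by
        intro φ hφ
        rw [Set.uIoc_of_le zero_le_one] at hφ
        rw [norm_mul, Real.norm_eq_abs, Real.norm_eq_abs]
        calc |κ φ| * |h (w (u * φ))| ≤ 1 * M := by
              gcongr
              · exact hκ1 φ ⟨hφ.1.le, hφ.2⟩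
              · exact hM _
          _ = M := one_mul M)
    simpa using this
  have hweight : ∀ u, |u| ^ N ≤ E u / μ := by
    intro u
    rw [le_div_iff₀ hμ]
    have := Real.add_one_le_exp (μ * |u| ^ N)
    simp only [hE]
    linarith
  set Φ : BoundedContinuousFunction ℝ ℝ → BoundedContinuousFunction ℝ ℝ := fun g =>
    BoundedContinuousFunction.ofNormedAddCommGroup
      (fun u => (E u)⁻¹ * (l - u ^ N * J (fun y => E y * g y) u))
      (by
        have h1 := hJc (fun y => E y * g y) (by fun_prop)
        have h2 : Continuous fun u => (E u)⁻¹ := hEc.inv₀ fun u => (hEpos u).ne'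
        fun_prop)
      (|l| + M / μ) (by
        intro u
        have h1 : 1 ≤ E u := Real.one_le_exp (by positivity)
        have h2 : |l - u ^ N * J (fun y => E y * g y) u| ≤ |l| + E u / μ * M := by
          refine (abs_sub _ _).trans ?_
          rw [abs_mul, abs_pow]
          gcongr
          · exact hweight u
          · exact hJb (fun y => E y * g y) u
        rw [norm_mul, norm_inv, Real.norm_eq_abs, Real.norm_eq_abs, abs_of_pos (hEpos u)]
        rw [inv_mul_le_iff₀ (hEpos u)]
        refine h2.trans ?_
        have : |l| * 1 ≤ |l| * E u := by gcongr
        calc |l| + E u / μ * M ≤ |l| * E u + E u / μ * M := by linarith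
          _ = E u * (|l| + M / μ) := by ring) with hΦ
  have hcontr : ContractingWith (1 / 2) Φ := by
    refine ⟨by rw [← NNReal.coe_lt_coe]; norm_num, LipschitzWith.of_dist_le_mul fun g₁ g₂ => ?_⟩
    rw [BoundedContinuousFunction.dist_le (by positivity)]
    intro u
    set D := dist g₁ g₂
    have hD0 : 0 ≤ D := dist_nonneg
    have hdiff : |J (fun y => E y * g₁ y) u - J (fun y => E y * g₂ y) u| ≤
        ∫ φ in (0 : ℝ)..1, (K * D) * (φ ^ (N - 1) * Real.exp (μ * (|u| * φ) ^ N)) := by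
      have hc1 : Continuous fun φ => κ φ * h (E (u * φ) * g₁ (u * φ)) := by fun_prop
      have hc2 : Continuous fun φ => κ φ * h (E (u * φ) * g₂ (u * φ)) := by fun_prop
      simp only [hJ]
      rw [← intervalIntegral.integral_sub (hc1.intervalIntegrable _ _)
        (hc2.intervalIntegrable _ _), ← Real.norm_eq_abs]
      apply intervalIntegral.norm_integral_le_of_norm_le zero_le_one
      · refine ae_of_all _ fun φ hφ => ?_
        have hφ' : φ ∈ Set.Icc (0 : ℝ) 1 := ⟨hφ.1.le, hφ.2⟩
        rw [← mul_sub, norm_mul, Real.norm_eq_abs]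
        have h1 : ‖h (E (u * φ) * g₁ (u * φ)) - h (E (u * φ) * g₂ (u * φ))‖ ≤
            K * (E (u * φ) * D) := by
          rw [← dist_eq_norm]
          refine (hK.dist_le_mul _ _).trans ?_
          gcongr
          rw [Real.dist_eq, ← mul_sub, abs_mul, abs_of_pos (hEpos _)]
          gcongr
          exact BoundedContinuousFunction.dist_coe_le_dist (f := g₁) (g := g₂) (u * φ)
        calc _ ≤ φ ^ (N - 1) * (K * (E (u * φ) * D)) := by
              exact mul_le_mul (hκ φ hφ') h1 (norm_nonneg _) (pow_nonneg hφ'.1 _)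
          _ = _ := by
              simp only [hE, abs_mul, abs_of_nonneg hφ'.1]
              ring
      · apply Continuous.intervalIntegrable
        fun_prop
    rw [intervalIntegral.integral_const_mul] at hdiff
    have hexp := pow_mul_integral_exp_le N hN hμ |u|
    have h0 : dist (Φ g₁ u) (Φ g₂ u) = (E u)⁻¹ * (|u| ^ N *
        |J (fun y => E y * g₁ y) u - J (fun y => E y * g₂ y) u|) := by
      simp only [hΦ, BoundedContinuousFunction.coe_ofNormedAddCommGroup, Real.dist_eq]
      rw [← mul_sub, abs_mul, abs_inv, abs_of_pos (hEpos u), ← abs_pow, ← abs_mul, ← abs_neg (_ - _)]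
      congr 2; ring
    rw [h0, inv_mul_le_iff₀ (hEpos u)]
    calc |u| ^ N * |J (fun y => E y * g₁ y) u - J (fun y => E y * g₂ y) u|
        ≤ |u| ^ N * ((K * D) * ∫ φ in (0 : ℝ)..1, φ ^ (N - 1) * Real.exp (μ * (|u| * φ) ^ N)) := by
          gcongr
      _ = (K * D) * (|u| ^ N * ∫ φ in (0 : ℝ)..1, φ ^ (N - 1) * Real.exp (μ * (|u| * φ) ^ N)) := by
          ring
      _ ≤ (K * D) * (E u / μ) := by gcongr
      _ = (K / μ) * (E u * D) := by ring
      _ ≤ (1 / 2) * (E u * D) := by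
          have := hEpos u
          gcongr ?_ * _
          rw [div_le_iff₀ hμ]
          linarith
      _ = E u * (((1 / 2 : NNReal) : ℝ) * D) := by push_cast; ring
  set g := ContractingWith.fixedPoint Φ hcontr with hg
  have hfix : Φ g = g := ContractingWith.fixedPoint_isFixedPt hcontr
  refine ⟨fun y => E y * g y, by fun_prop, fun u => ?_⟩
  have h1 : Φ g u = g u := by rw [hfix]
  simp only [hΦ, BoundedContinuousFunction.coe_ofNormedAddCommGroup] at h1
  change E u * g u = l - u ^ N * J (fun y => E y * g y) u
  rw [← h1, ← mul_assoc, mul_inv_cancel₀ (hEpos u).ne', one_mul]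

/-! ### The profile at infinity -/

theorem abs_pow_sub_pow_le_of_abs_le {L a b : ℝ} (p : ℕ) (ha : |a| ≤ L) (hb : |b| ≤ L) :
    |a ^ p - b ^ p| ≤ p * L ^ (p - 1) * |a - b| := by
  have h := Convex.norm_image_sub_le_of_norm_hasDerivWithin_le (f := fun x : ℝ => x ^ p)
    (f' := fun x => p * x ^ (p - 1)) (s := Set.Icc (-L) L) (C := p * L ^ (p - 1)) (x := b) (y := a)
    (fun x _ => (hasDerivAt_pow p x).hasDerivWithinAt) (fun x hx => by
      rw [norm_mul, norm_pow, Real.norm_natCast, Real.norm_eq_abs]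
      gcongr
      exact abs_le.2 hx) (convex_Icc _ _) (abs_le.1 hb) (abs_le.1 ha)
  simpa using h

/-- A bounded globally Lipschitz function that agrees with `w ^ p` for `|w| ≤ L`. -/
theorem exists_truncated_pow (p : ℕ) {L : ℝ} (hL : 0 ≤ L) :
    ∃ (h : ℝ → ℝ) (K : NNReal), LipschitzWith K h ∧ (∀ w, |h w| ≤ L ^ p) ∧
      ∀ w, |w| ≤ L → h w = w ^ p := by
  have hcl : ∀ w, |max (-L) (min L w)| ≤ L := fun w =>
    abs_le.2 ⟨le_max_left _ _, max_le (by linarith) (min_le_left _ _)⟩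
  refine ⟨fun w => (max (-L) (min L w)) ^ p, ⟨p * L ^ (p - 1), by positivity⟩, ?_, ?_, ?_⟩
  · refine LipschitzWith.of_dist_le_mul fun a b => ?_
    rw [Real.dist_eq, Real.dist_eq]
    refine (abs_pow_sub_pow_le_of_abs_le p (hcl a) (hcl b)).trans ?_
    change _ ≤ p * L ^ (p - 1) * |a - b|
    refine mul_le_mul_of_nonneg_left ?_ (by positivity)
    refine (abs_max_sub_max_le_max (-L) (min L a) (-L) (min L b)).trans ?_
    refine max_le (by simp) ((abs_min_sub_min_le_max L a L b).trans (max_le (by simp) le_rfl))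
  · intro w
    rw [abs_pow]
    gcongr
    exact hcl w
  · intro w hw
    have := abs_le.1 hw
    simp only [min_eq_right this.2, max_eq_right this.1]

/-- `u W' = k (Q - W)` when `(u ^ k W)' = k u ^ (k-1) Q`. -/
theorem hasDerivAt_of_pow_mul {k : ℕ} (hk : 1 ≤ k) {W : ℝ → ℝ} {q u : ℝ} (hu : 0 < u)
    (hY : HasDerivAt (fun u => u ^ k * W u) (k * u ^ (k - 1) * q) u) :
    HasDerivAt W (k * (q - W u) / u) u := by
  have h1 : HasDerivAt (fun x => (x ^ k * W x) / x ^ k)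
      ((k * u ^ (k - 1) * q * u ^ k - (u ^ k * W u) * (k * u ^ (k - 1))) / (u ^ k) ^ 2) u :=
    hY.div (hasDerivAt_pow k u) (by positivity)
  have h2 : (fun x => (x ^ k * W x) / x ^ k) =ᶠ[𝓝 u] W := by
    filter_upwards [lt_mem_nhds hu] with x hx
    have : x ^ k ≠ 0 := by positivity
    field_simp
  refine (h1.congr_of_eventuallyEq h2.symm).congr_deriv ?_
  obtain ⟨n, rfl⟩ : ∃ n, k = n + 1 := ⟨k - 1, by omega⟩
  simp only [Nat.add_sub_cancel]
  field_simp
  ring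

/-- The energy `Q ^ 2 / 2 + u ^ N W ^ (p+1) / ((p+1) k ^ 2)` is nonincreasing in `u`, and equals
`l ^ 2 / 2` at `u = 0`. -/
theorem energy_bound (k p N : ℕ) (hk : 1 ≤ k) (hp : Odd p) (hN : 1 ≤ N) (hkp : k * p = N + k + 2)
    {l U : ℝ} (hU : 0 < U) {W Q : ℝ → ℝ} (hWc : Continuous W) (hQc : Continuous Q) (hQ0 : Q 0 = l)
    (hY : ∀ u, 0 < u → HasDerivAt (fun u => u ^ k * W u) (k * u ^ (k - 1) * Q u) u)
    (hQ : ∀ u ∈ Set.Ioo 0 U, HasDerivAt Q (-(1 / k) * u ^ (N - 1) * W u ^ p) u) :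
    ∀ u ∈ Set.Icc 0 U, |Q u| ≤ |l| := by
  have hk0 : (0 : ℝ) < k := by exact_mod_cast hk
  set A : ℝ := 1 / ((p + 1) * k ^ 2) with hA
  have hA0 : 0 < A := by positivity
  have heven : Even (p + 1) := hp.add_one
  set F : ℝ → ℝ := fun u => Q u ^ 2 / 2 + A * (u ^ N * W u ^ (p + 1)) with hF
  have hFd : ∀ u ∈ Set.Ioo 0 U,
      HasDerivAt F (-(A * u ^ (N - 1) * W u ^ (p + 1) * (2 * k + 2))) u := by
    intro u hu
    have hu0 : 0 < u := hu.1
    have hW := hasDerivAt_of_pow_mul hk hu0 (hY u hu0)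
    have h1 := (((hQ u hu).pow 2).div_const 2).add
      (((hasDerivAt_pow N u).mul (hW.pow (p + 1))).const_mul A)
    refine h1.congr_deriv ?_
    obtain ⟨n, rfl⟩ : ∃ n, N = n + 1 := ⟨N - 1, by omega⟩
    have hr : (k : ℝ) * p = n + 1 + k + 2 := by exact_mod_cast hkp
    simp only [hA, Nat.add_sub_cancel, Nat.cast_add, Nat.cast_one]
    have : (n : ℝ) = k * p - k - 3 := by linarith
    rw [this]
    simp only [pow_succ, Pi.pow_apply]
    field_simp
    ring
  have hanti : AntitoneOn F (Set.Icc 0 U) := by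
    apply antitoneOn_of_deriv_nonpos (convex_Icc 0 U)
    · have : Continuous F := by fun_prop
      exact this.continuousOn
    · intro u hu
      rw [interior_Icc] at hu
      exact (hFd u hu).differentiableAt.differentiableWithinAt
    · intro u hu
      rw [interior_Icc] at hu
      rw [(hFd u hu).deriv]
      have h1 := hu.1
      have := heven.pow_nonneg (W u)
      have : 0 ≤ A * u ^ (N - 1) * W u ^ (p + 1) * (2 * k + 2) := by positivity
      linarith
  intro u hu
  have h1 := hanti (Set.left_mem_Icc.2 hU.le) hu hu.1
  have h2 : F 0 = l ^ 2 / 2 := by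
    simp [hF, hQ0, show N ≠ 0 by omega]
  have h3 : 0 ≤ A * (u ^ N * W u ^ (p + 1)) := by
    have := heven.pow_nonneg (W u)
    have := hu.1
    positivity
  rw [h2] at h1
  simp only [hF] at h1
  exact sq_le_sq.1 (by linarith)

/-- Integrating `(u ^ k W)' = k u ^ (k-1) Q` from `0`, a bound for `Q` carries over to `W`. -/
theorem abs_le_of_abs_slope_le (k : ℕ) (hk : 1 ≤ k) {l U : ℝ} (hU : 0 < U) {W Q : ℝ → ℝ}
    (hWc : Continuous W)
    (hY : ∀ u, 0 < u → HasDerivAt (fun u => u ^ k * W u) (k * u ^ (k - 1) * Q u) u)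
    (hQ : ∀ u ∈ Set.Icc 0 U, |Q u| ≤ |l|) : |W U| ≤ |l| := by
  have key : ∀ s : ℝ, |s| = 1 → s * W U ≤ |l| := by
    intro s hs
    have hm : MonotoneOn (fun u => |l| * u ^ k - s * (u ^ k * W u)) (Set.Icc 0 U) := by
      have hd : ∀ u, 0 < u → HasDerivAt (fun u => |l| * u ^ k - s * (u ^ k * W u))
          (|l| * (k * u ^ (k - 1)) - s * (k * u ^ (k - 1) * Q u)) u := fun u hu =>
        ((hasDerivAt_pow k u).const_mul _).sub ((hY u hu).const_mul s)
      apply monotoneOn_of_deriv_nonneg (convex_Icc 0 U)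
      · fun_prop
      · intro u hu
        rw [interior_Icc] at hu
        exact (hd u hu.1).differentiableAt.differentiableWithinAt
      · intro u hu
        rw [interior_Icc] at hu
        rw [(hd u hu.1).deriv]
        have h1 : s * Q u ≤ |l| := by
          refine (le_abs_self _).trans ?_
          rw [abs_mul, hs, one_mul]
          exact hQ u ⟨hu.1.le, hu.2.le⟩
        have h2 : 0 ≤ (k : ℝ) * u ^ (k - 1) := by have := hu.1; positivity
        nlinarith
    have := hm (Set.left_mem_Icc.2 hU.le) (Set.right_mem_Icc.2 hU.le) hU.le
    simp only [zero_pow (show k ≠ 0 by omega)] at this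
    have hUk : 0 < U ^ k := by positivity
    nlinarith
  rw [abs_le]
  constructor
  · have := key (-1) (by simp)
    linarith
  · have := key 1 (by simp)
    linarith

/-- The profile `W(u) = u ^ (-k) z(1/u)` of a solution `z` of the radial equation in dimension
`k + 2`, on the whole half-line; `Q` is its slope, `(u ^ k W)' = k u ^ (k-1) Q`. -/
theorem exists_profile (k p N : ℕ) (hk : 1 ≤ k) (hp : Odd p) (hN : 1 ≤ N)
    (hkp : k * p = N + k + 2) (l : ℝ) :
    ∃ W Q : ℝ → ℝ, Continuous W ∧ Continuous Q ∧ W 0 = l ∧ Q 0 = l ∧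
      (∀ u, 0 < u → HasDerivAt (fun u => u ^ k * W u) (k * u ^ (k - 1) * Q u) u) ∧
      (∀ u, 0 < u → HasDerivAt Q (-(1 / k) * u ^ (N - 1) * W u ^ p) u) ∧
      ∃ C, ∀ u, 0 ≤ u → |W u - l| ≤ C * u ^ N := by
  have hk0 : (0 : ℝ) < k := by exact_mod_cast hk
  have hk1 : (1 : ℝ) ≤ k := by exact_mod_cast hk
  set L : ℝ := |l| + 1 with hL
  have hL0 : 0 ≤ L := by positivity
  obtain ⟨h, K, hK, hM, hpow⟩ := exists_truncated_pow p hL0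
  have hκ : ∀ φ ∈ Set.Icc (0 : ℝ) 1, |(1 / k) * ((1 - φ ^ k) * φ ^ (N - 1))| ≤ φ ^ (N - 1) := by
    intro φ hφ
    have h1 : φ ^ k ≤ 1 := pow_le_one₀ hφ.1 hφ.2
    have h0 : 0 ≤ φ ^ k := pow_nonneg hφ.1 _
    have h2 : 0 ≤ φ ^ (N - 1) := pow_nonneg hφ.1 _
    have h3 : 0 ≤ 1 - φ ^ k := by linarith
    rw [abs_of_nonneg (by positivity), ← mul_assoc]
    refine mul_le_of_le_one_left h2 ?_
    have : (1 : ℝ) / k ≤ 1 := by rw [div_le_one hk0]; exact hk1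
    have : (0 : ℝ) ≤ 1 / k := by positivity
    nlinarith
  -- the kernel is the Green function of `(u ^ k W)' = k u ^ (k-1) Q`, `Q' = -u ^ (N-1) h(W) / k`
  -- for data at `u = 0`, rescaled to the unit interval
  obtain ⟨W, hWc, hW⟩ := exists_volterra_solution N hN
    (fun φ => (1 / k) * ((1 - φ ^ k) * φ ^ (N - 1))) h (by fun_prop) hκ K hK (L ^ p) hM l
  have hhc : Continuous h := hK.continuous
  set a : ℝ → ℝ := fun τ => τ ^ (N - 1) * h (W τ) with ha
  have hac : Continuous a := by fun_prop
  set b : ℝ → ℝ := fun τ => τ ^ k * a τ with hb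
  have hbc : Continuous b := by fun_prop
  set A : ℝ → ℝ := fun u => ∫ τ in (0 : ℝ)..u, a τ with hAdef
  set B : ℝ → ℝ := fun u => ∫ τ in (0 : ℝ)..u, b τ with hBdef
  have hA : ∀ u, HasDerivAt A (a u) u := fun u => (hac.integral_hasStrictDerivAt 0 u).hasDerivAt
  have hB : ∀ u, HasDerivAt B (b u) u := fun u => (hbc.integral_hasStrictDerivAt 0 u).hasDerivAt
  set Q : ℝ → ℝ := fun u => l - (1 / k) * A u with hQdef
  have hQd : ∀ u, HasDerivAt Q (-(1 / k * a u)) u := fun u =>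
    ((hA u).const_mul (1 / (k : ℝ))).const_sub l
  have hQc : Continuous Q := continuous_iff_continuousAt.2 fun u => (hQd u).continuousAt
  have hYeq : ∀ u, u ^ k * W u = l * u ^ k - (1 / k) * (u ^ k * A u - B u) := by
    intro u
    have h1 : u ^ k * A u - B u = u * ∫ φ in (0 : ℝ)..1, (u ^ k * a (u * φ) - b (u * φ)) := by
      rw [intervalIntegral.mul_integral_comp_mul_left (f := fun τ => u ^ k * a τ - b τ),
        intervalIntegral.integral_sub ((hac.const_mul _).intervalIntegrable _ _)
          (hbc.intervalIntegrable _ _), intervalIntegral.integral_const_mul]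
      simp [hAdef, hBdef]
    have h2 : ∫ φ in (0 : ℝ)..1, (u ^ k * a (u * φ) - b (u * φ)) =
        u ^ (k + N - 1) * ∫ φ in (0 : ℝ)..1, (1 - φ ^ k) * φ ^ (N - 1) * h (W (u * φ)) := by
      rw [← intervalIntegral.integral_const_mul]
      congr 1
      ext φ
      simp only [ha, hb]
      rw [show k + N - 1 = k + (N - 1) by omega, pow_add, mul_pow, mul_pow]
      ring
    have h3 : ∫ φ in (0 : ℝ)..1, (1 / k) * ((1 - φ ^ k) * φ ^ (N - 1)) * h (W (u * φ)) =
        (1 / k) * ∫ φ in (0 : ℝ)..1, (1 - φ ^ k) * φ ^ (N - 1) * h (W (u * φ)) := by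
      rw [← intervalIntegral.integral_const_mul]
      congr 1
      ext φ
      ring
    rw [hW u, h3, h1, h2]
    obtain ⟨n, rfl⟩ : ∃ n, N = n + 1 := ⟨N - 1, by omega⟩
    rw [show k + (n + 1) - 1 = k + n by omega, pow_add, pow_add]
    ring
  have hQ0 : Q 0 = l := by simp [hQdef, hAdef]
  have hW0 : W 0 = l := by rw [hW 0]; simp [show N ≠ 0 by omega]
  have hY : ∀ u, 0 < u → HasDerivAt (fun u => u ^ k * W u) (k * u ^ (k - 1) * Q u) u := by
    intro u hu
    have h1 := ((hasDerivAt_pow k u).const_mul l).sub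
      (((((hasDerivAt_pow k u).mul (hA u)).sub (hB u))).const_mul (1 / (k : ℝ)))
    have h2 : (fun u => u ^ k * W u) = fun u => l * u ^ k - (1 / k) * (u ^ k * A u - B u) :=
      funext hYeq
    rw [h2]
    refine h1.congr_deriv ?_
    simp only [hb, hQdef]
    ring
  have hQd' : ∀ u, |W u| ≤ L → HasDerivAt Q (-(1 / k) * u ^ (N - 1) * W u ^ p) u := by
    intro u hu
    refine (hQd u).congr_deriv ?_
    simp only [ha]
    rw [hpow _ hu]
    ring
  -- the energy bound propagates as long as the truncation is inactive
  have hstep : ∀ U, 0 < U → (∀ u ∈ Set.Ioo 0 U, |W u| ≤ L) → |W U| ≤ |l| := fun U hU hWU =>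
    abs_le_of_abs_slope_le k hk hU hWc hY
      (energy_bound k p N hk hp hN hkp hU hWc hQc hQ0 hY fun u hu => hQd' u (hWU u hu))
  have hWb : ∀ U, 0 < U → |W U| < L := by
    by_contra! hcon
    obtain ⟨U, hU, hWU⟩ := hcon
    have hcomp : IsCompact (Set.Icc 0 U ∩ {u | L ≤ |W u|}) :=
      isCompact_Icc.inter_right (isClosed_le continuous_const hWc.abs)
    -- `u₀` is the first point where the truncation level is reached
    obtain ⟨u₀, hu₀, hleast⟩ := hcomp.exists_isLeast ⟨U, ⟨hU.le, le_rfl⟩, hWU⟩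
    have hu₀L : L ≤ |W u₀| := hu₀.2
    have hpos : 0 < u₀ := by
      rcases hu₀.1.1.lt_or_eq with h0 | h0
      · exact h0
      · rw [← h0, hW0] at hu₀L
        linarith
    have := hstep u₀ hpos fun u hu => by
      by_contra! hlt
      exact absurd (hleast ⟨⟨hu.1.le, hu.2.le.trans hu₀.1.2⟩, hlt.le⟩) (not_le.2 hu.2)
    linarith
  refine ⟨W, Q, hWc, hQc, hW0, hQ0, hY, fun u hu => hQd' u (hWb u hu).le, L ^ p, fun u hu => ?_⟩
  have h1 := intervalIntegral.norm_integral_le_of_norm_le_const (a := (0 : ℝ)) (b := 1) (C := L ^ p)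
    (f := fun φ => (1 / k) * ((1 - φ ^ k) * φ ^ (N - 1)) * h (W (u * φ))) (by
      intro φ hφ
      rw [Set.uIoc_of_le zero_le_one] at hφ
      have hφ' : φ ∈ Set.Icc (0 : ℝ) 1 := ⟨hφ.1.le, hφ.2⟩
      rw [norm_mul, Real.norm_eq_abs, Real.norm_eq_abs]
      calc _ ≤ 1 * L ^ p := mul_le_mul ((hκ φ hφ').trans (pow_le_one₀ hφ'.1 hφ'.2)) (hM _)
            (abs_nonneg _) zero_le_one
        _ = L ^ p := one_mul _)
  rw [hW u, sub_sub_cancel_left, abs_neg, abs_mul, abs_of_nonneg (pow_nonneg hu N), mul_comm]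
  simp only [sub_zero, abs_one, mul_one, Real.norm_eq_abs] at h1
  gcongr

/-! ### The Emden-Fowler energy -/

/-- The energy `P ^ 2 / 2 - b v ^ 2 / 2 + v ^ (p+1) / (p+1)` of the Emden-Fowler equation
`v'' = c v' + b v - v ^ p`, with `P` in the role of `v'`. -/
noncomputable def emdenEnergy (p : ℕ) (b : ℝ) (v P : ℝ → ℝ) (τ : ℝ) : ℝ :=
  P τ ^ 2 / 2 - b / 2 * v τ ^ 2 + v τ ^ (p + 1) / (p + 1)

theorem hasDerivAt_emdenEnergy {p : ℕ} {b c : ℝ} {v P : ℝ → ℝ} (hv : ∀ τ, HasDerivAt v (P τ) τ)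
    (hP : ∀ τ, HasDerivAt P (c * P τ + b * v τ - v τ ^ p) τ) (τ : ℝ) :
    HasDerivAt (emdenEnergy p b v P) (c * P τ ^ 2) τ := by
  have h1 := ((((hP τ).pow 2).div_const 2).sub (((hv τ).pow 2).const_mul (b / 2))).add
    (((hv τ).pow (p + 1)).div_const ((p : ℝ) + 1))
  refine h1.congr_deriv ?_
  have : (p : ℝ) + 1 ≠ 0 := by positivity
  simp only [Nat.add_sub_cancel, Nat.cast_add, Nat.cast_one]
  field_simp
  ring

theorem monotone_emdenEnergy {p : ℕ} {b c : ℝ} (hc : 0 ≤ c) {v P : ℝ → ℝ}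
    (hv : ∀ τ, HasDerivAt v (P τ) τ)
    (hP : ∀ τ, HasDerivAt P (c * P τ + b * v τ - v τ ^ p) τ) : Monotone (emdenEnergy p b v P) := by
  apply monotone_of_deriv_nonneg
  · exact fun τ => (hasDerivAt_emdenEnergy hv hP τ).differentiableAt
  · intro τ
    rw [(hasDerivAt_emdenEnergy hv hP τ).deriv]
    positivity

theorem exists_le_of_integral_lt {g : ℝ → ℝ} (hg : Continuous g) {s t ε : ℝ}
    (hst : s ≤ t) (h : ∫ x in s..t, g x < (t - s) * ε) : ∃ x ∈ Set.Icc s t, g x ≤ ε := by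
  by_contra! hcon
  have h1 : ∫ _ in s..t, ε ≤ ∫ x in s..t, g x :=
    intervalIntegral.integral_mono_on hst (continuous_const.intervalIntegrable _ _)
      (hg.intervalIntegrable _ _) fun x hx => (hcon x hx).le
  rw [intervalIntegral.integral_const, smul_eq_mul] at h1
  linarith

/-- A solution whose energy is once positive does not vanish asymptotically, even in the mean over
unit windows. No upper bound on the energy is assumed: `v` may oscillate with growing amplitude. -/
theorem not_tendsto_integral_window {p : ℕ} (hp : Odd p) {b c : ℝ} (hb : 0 ≤ b) (hc : 0 ≤ c)
    {v P : ℝ → ℝ} (hv : ∀ τ, HasDerivAt v (P τ) τ)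
    (hP : ∀ τ, HasDerivAt P (c * P τ + b * v τ - v τ ^ p) τ) {τ₀ : ℝ}
    (hE : 0 < emdenEnergy p b v P τ₀) :
    ¬ Tendsto (fun T => ∫ t in T..(T + 1), (|v t| + |v t| ^ p)) atTop (𝓝 0) := by
  intro htend
  have hvc : Continuous v := continuous_iff_continuousAt.2 fun τ => (hv τ).continuousAt
  have hPc : Continuous P := continuous_iff_continuousAt.2 fun τ => (hP τ).continuousAt
  set g : ℝ → ℝ := fun t => |v t| + |v t| ^ p with hg
  have hgc : Continuous g := by fun_prop
  have hg0 : ∀ t, 0 ≤ g t := fun t => by positivity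
  set e := emdenEnergy p b v P τ₀ with he
  -- `C ε` will bound `P`, and `D ε ^ 2` the energy, at a point of the window
  set C : ℝ := 21 + 3 * b + 6 * c with hC
  have hC0 : 0 < C := by positivity
  set D : ℝ := C ^ 2 / 2 + 9 with hD
  have hD0 : 0 < D := by positivity
  set ε : ℝ := min 1 (e / (2 * D)) with hε
  have hε0 : 0 < ε := lt_min one_pos (by positivity)
  obtain ⟨T, hTI, hT⟩ := ((htend.eventually_lt_const hε0).and (eventually_ge_atTop τ₀)).exists
  have hsub : ∀ s t, T ≤ s → s ≤ t → t ≤ T + 1 → ∫ x in s..t, g x < ε := by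
    intro s t h1 h2 h3
    refine lt_of_le_of_lt ?_ hTI
    exact intervalIntegral.integral_mono_interval h1 h2 h3 (ae_of_all _ hg0)
      (hgc.intervalIntegrable _ _)
  obtain ⟨t₁, ht₁, hgt₁⟩ := exists_le_of_integral_lt hgc (s := T) (t := T + 1 / 3) (ε := 3 * ε)
    (by linarith) (by linarith [hsub T (T + 1 / 3) le_rfl (by linarith) (by linarith)])
  obtain ⟨t₂, ht₂, hgt₂⟩ := exists_le_of_integral_lt hgc (s := T + 2 / 3) (t := T + 1)
    (ε := 3 * ε) (by linarith)
    (by linarith [hsub (T + 2 / 3) (T + 1) (by linarith) (by linarith) (by linarith)])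
  have h12 : t₁ + 1 / 3 ≤ t₂ := by linarith [ht₁.2, ht₂.1]
  have hvt : ∀ t, g t ≤ 3 * ε → |v t| ≤ 3 * ε ∧ |v t| ^ p ≤ 3 * ε := by
    intro t ht
    have h1 : 0 ≤ |v t| := abs_nonneg _
    have h2 : 0 ≤ |v t| ^ p := by positivity
    simp only [hg] at ht
    exact ⟨by linarith, by linarith⟩
  -- `P - c v` is nearly constant between `t₁` and `t₂`
  set w : ℝ → ℝ := fun t => P t - c * v t with hw
  have hwd : ∀ t, HasDerivAt w (b * v t - v t ^ p) t := fun t =>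
    ((hP t).sub ((hv t).const_mul c)).congr_deriv (by ring)
  have hwc : Continuous w := by fun_prop
  have hosc : ∀ t ∈ Set.Icc t₁ t₂, |w t - w t₁| ≤ (b + 1) * ε := by
    intro t ht
    have h1 : ∫ x in t₁..t, (b * v x - v x ^ p) = w t - w t₁ :=
      intervalIntegral.integral_eq_sub_of_hasDerivAt (fun x _ => hwd x)
        (Continuous.intervalIntegrable (by fun_prop) _ _)
    rw [← h1, ← Real.norm_eq_abs]
    have h2 : ‖∫ x in t₁..t, (b * v x - v x ^ p)‖ ≤ ∫ x in t₁..t, (b + 1) * g x := by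
      apply intervalIntegral.norm_integral_le_of_norm_le ht.1
      · refine ae_of_all _ fun x _ => ?_
        rw [Real.norm_eq_abs]
        refine (abs_sub _ _).trans ?_
        rw [abs_mul, abs_of_nonneg hb, abs_pow]
        simp only [hg]
        have h3 : 0 ≤ |v x| := abs_nonneg _
        have h4 : 0 ≤ |v x| ^ p := by positivity
        nlinarith
      · exact Continuous.intervalIntegrable (by fun_prop) _ _
    refine h2.trans ?_
    rw [intervalIntegral.integral_const_mul]
    gcongr
    exact (hsub t₁ t ht₁.1 ht.1 (by linarith [ht.2, ht₂.2])).le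
  have hintw : ∫ x in t₁..t₂, (P x - c * v x - w t₁) =
      v t₂ - v t₁ - c * (∫ x in t₁..t₂, v x) - (t₂ - t₁) * w t₁ := by
    rw [intervalIntegral.integral_sub (Continuous.intervalIntegrable (by fun_prop) _ _)
      (continuous_const.intervalIntegrable _ _), intervalIntegral.integral_sub
      (hPc.intervalIntegrable _ _) (Continuous.intervalIntegrable (by fun_prop) _ _),
      intervalIntegral.integral_const_mul, intervalIntegral.integral_const, smul_eq_mul,
      intervalIntegral.integral_eq_sub_of_hasDerivAt (fun x _ => hv x)
        (hPc.intervalIntegrable _ _)]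
  have hintle : |∫ x in t₁..t₂, (P x - c * v x - w t₁)| ≤ (b + 1) * ε * (t₂ - t₁) := by
    have := intervalIntegral.norm_integral_le_of_norm_le_const (a := t₁) (b := t₂)
      (C := (b + 1) * ε) (f := fun x => P x - c * v x - w t₁) (by
        intro x hx
        rw [Set.uIoc_of_le (by linarith)] at hx
        exact hosc x ⟨hx.1.le, hx.2⟩)
    rwa [abs_of_nonneg (by linarith : 0 ≤ t₂ - t₁)] at this
  have hintv : |∫ x in t₁..t₂, v x| ≤ ε := by
    have h2 : ‖∫ x in t₁..t₂, v x‖ ≤ ∫ x in t₁..t₂, g x := by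
      apply intervalIntegral.norm_integral_le_of_norm_le (by linarith)
      · refine ae_of_all _ fun x _ => ?_
        have h4 : 0 ≤ |v x| ^ p := by positivity
        simp only [hg, Real.norm_eq_abs]
        linarith
      · exact hgc.intervalIntegrable _ _
    exact h2.trans (hsub t₁ t₂ ht₁.1 (by linarith) ht₂.2).le
  obtain ⟨hv1, hv1p⟩ := hvt t₁ hgt₁
  obtain ⟨hv2, -⟩ := hvt t₂ hgt₂
  have hlen : t₂ - t₁ ≤ 1 := by linarith [ht₁.1, ht₂.2]
  have hwt : |w t₁| ≤ 3 * (7 + b + c) * ε := by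
    have h1 : (t₂ - t₁) * w t₁ =
        v t₂ - v t₁ - c * (∫ x in t₁..t₂, v x) - ∫ x in t₁..t₂, (P x - c * v x - w t₁) := by
      rw [hintw]; ring
    have h2 : |(t₂ - t₁) * w t₁| ≤ 3 * ε + 3 * ε + c * ε + (b + 1) * ε := by
      rw [h1]
      refine (abs_sub _ _).trans (add_le_add ((abs_sub _ _).trans (add_le_add
        ((abs_sub _ _).trans (add_le_add hv2 hv1)) ?_)) ?_)
      · rw [abs_mul, abs_of_nonneg hc]
        gcongr
      · refine hintle.trans (mul_le_of_le_one_right (by positivity) hlen)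
    rw [abs_mul, abs_of_nonneg (by linarith : 0 ≤ t₂ - t₁)] at h2
    nlinarith [abs_nonneg (w t₁)]
  have hPt : |P t₁| ≤ C * ε := by
    have h1 : P t₁ = w t₁ + c * v t₁ := by simp [hw]
    rw [h1]
    refine (abs_add_le _ _).trans ?_
    rw [abs_mul, abs_of_nonneg hc, hC]
    nlinarith
  have hEt : e ≤ emdenEnergy p b v P t₁ := monotone_emdenEnergy hc hv hP (by linarith [ht₁.1])
  have hE1 : emdenEnergy p b v P t₁ ≤ D * ε ^ 2 := by
    have h1 : P t₁ ^ 2 ≤ (C * ε) ^ 2 := by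
      rw [← sq_abs]; gcongr
    have h2 : v t₁ ^ (p + 1) / (p + 1) ≤ 9 * ε ^ 2 := by
      have h4 : 0 ≤ v t₁ ^ (p + 1) := hp.add_one.pow_nonneg _
      calc v t₁ ^ (p + 1) / (p + 1) ≤ v t₁ ^ (p + 1) :=
            div_le_self h4 (by linarith [(Nat.cast_nonneg p : (0 : ℝ) ≤ p)])
        _ = |v t₁| ^ p * |v t₁| := by rw [← pow_succ, hp.add_one.pow_abs]
        _ ≤ (3 * ε) * (3 * ε) := by gcongr
        _ = 9 * ε ^ 2 := by ring
    have h3 : 0 ≤ b / 2 * v t₁ ^ 2 := by positivity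
    simp only [emdenEnergy, hD]
    nlinarith
  have hε1 : ε ≤ 1 := min_le_left _ _
  have hεe : ε * (2 * D) ≤ e := by
    rw [← le_div_iff₀ (by positivity)]
    exact min_le_right _ _
  have : D * ε ^ 2 ≤ D * ε := by
    gcongr
    nlinarith
  linarith

/-- The profile equations in the logarithmic variable `u = exp τ`, for
`v(τ) = exp ((k - a) τ) W(exp τ)`; the condition on `a` makes the equation autonomous. -/
theorem hasDerivAt_emden {k p N : ℕ} (hk : 1 ≤ k) (hN : 1 ≤ N) {a : ℝ}
    (ha : (p - 1) * (k - a) = (N : ℝ)) {W Q : ℝ → ℝ}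
    (hY : ∀ u, 0 < u → HasDerivAt (fun u => u ^ k * W u) (k * u ^ (k - 1) * Q u) u)
    (hQ : ∀ u, 0 < u → HasDerivAt Q (-(1 / k) * u ^ (N - 1) * W u ^ p) u) (τ : ℝ) :
    HasDerivAt (fun τ => Real.exp ((k - a) * τ) * W (Real.exp τ))
      (Real.exp ((k - a) * τ) * (k * Q (Real.exp τ) - a * W (Real.exp τ))) τ ∧
    HasDerivAt (fun τ => Real.exp ((k - a) * τ) * (k * Q (Real.exp τ) - a * W (Real.exp τ)))
      ((k - 2 * a) * (Real.exp ((k - a) * τ) * (k * Q (Real.exp τ) - a * W (Real.exp τ))) +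
        a * (k - a) * (Real.exp ((k - a) * τ) * W (Real.exp τ)) -
        (Real.exp ((k - a) * τ) * W (Real.exp τ)) ^ p) τ := by
  have hk0 : (0 : ℝ) < k := by exact_mod_cast hk
  have hu := Real.exp_pos τ
  have hW := (hasDerivAt_of_pow_mul hk hu (hY _ hu)).comp τ (Real.hasDerivAt_exp τ)
  have hQ' := (hQ _ hu).comp τ (Real.hasDerivAt_exp τ)
  have hexp : HasDerivAt (fun τ => Real.exp ((k - a) * τ))
      (Real.exp ((k - a) * τ) * ((k - a) * 1)) τ :=
    ((hasDerivAt_id τ).const_mul ((k : ℝ) - a)).exp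
  constructor
  · refine (hexp.mul hW).congr_deriv ?_
    simp only [Function.comp_apply]
    field_simp
    ring
  · refine (hexp.mul ((hQ'.const_mul (k : ℝ)).sub (hW.const_mul a))).congr_deriv ?_
    have hpow : Real.exp ((k - a) * τ) ^ p = Real.exp ((k - a) * τ) * Real.exp τ ^ N := by
      rw [← Real.exp_nat_mul, ← Real.exp_nat_mul, ← Real.exp_add, ← ha]
      congr 1; ring
    rw [mul_pow, hpow]
    obtain ⟨n, rfl⟩ : ∃ n, N = n + 1 := ⟨N - 1, by omega⟩
    simp only [Pi.sub_apply, Function.comp_apply, Nat.add_sub_cancel, pow_succ]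
    field_simp
    ring

/-- The energy comes from `0` at `-∞`, so if it were never positive it would vanish identically,
and so would its derivative `c P ^ 2`. -/
theorem exists_emdenEnergy_pos {p : ℕ} {b c : ℝ} (hc : 0 < c) {v P : ℝ → ℝ}
    (hv : ∀ τ, HasDerivAt v (P τ) τ)
    (hP : ∀ τ, HasDerivAt P (c * P τ + b * v τ - v τ ^ p) τ)
    (hv0 : Tendsto v atBot (𝓝 0)) (hP0 : Tendsto P atBot (𝓝 0)) (hne : ∃ τ, P τ ≠ 0) :
    ∃ τ, 0 < emdenEnergy p b v P τ := by
  by_contra! hcon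
  have hlim : Tendsto (emdenEnergy p b v P) atBot (𝓝 0) := by
    have := (((hP0.pow 2).div_const 2).sub ((hv0.pow 2).const_mul (b / 2))).add
      ((hv0.pow (p + 1)).div_const ((p : ℝ) + 1))
    simp only [ne_eq, OfNat.ofNat_ne_zero, not_false_eq_true, zero_pow, Nat.add_eq_zero_iff,
      one_ne_zero, and_false, zero_div, mul_zero, sub_zero, add_zero] at this
    exact this
  have hzero : emdenEnergy p b v P = fun _ => 0 := by
    ext τ
    exact le_antisymm (hcon τ) ((monotone_emdenEnergy hc.le hv hP).le_of_tendsto hlim τ)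
  obtain ⟨τ, hτ⟩ := hne
  have h1 := hasDerivAt_emdenEnergy hv hP τ
  rw [hzero] at h1
  have h2 := h1.unique (hasDerivAt_const τ (0 : ℝ))
  have : 0 < c * P τ ^ 2 := by positivity
  linarith

/-! ### Polar coordinates for the lower Lebesgue integral -/

section Polar

variable {E : Type*} [NormedAddCommGroup E] [NormedSpace ℝ E] [FiniteDimensional ℝ E]
  [MeasurableSpace E] [BorelSpace E] [Nontrivial E] (μ : Measure E) [μ.IsAddHaarMeasure]

theorem lintegral_polar {F : E → ℝ≥0∞} (hF : Measurable F) :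
    ∫⁻ x, F x ∂μ = ∫⁻ θ, (∫⁻ r in Set.Ioi (0 : ℝ),
      ENNReal.ofReal (r ^ (Module.finrank ℝ E - 1)) * F (r • (θ : E))) ∂μ.toSphere := by
  calc ∫⁻ x, F x ∂μ = ∫⁻ x : ({(0 : E)}ᶜ : Set E), F x ∂(μ.comap (↑)) := by
        rw [lintegral_subtype_comap (measurableSet_singleton _).compl, restrict_compl_singleton]
    _ = ∫⁻ q, F ((q.2 : ℝ) • (q.1 : E))
          ∂μ.toSphere.prod (.volumeIoiPow (Module.finrank ℝ E - 1)) := by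
        rw [← μ.measurePreserving_homeomorphUnitSphereProd.lintegral_comp_emb
          (Homeomorph.measurableEmbedding _)]
        refine lintegral_congr fun x => ?_
        have hx : ‖(x : E)‖ ≠ 0 := norm_ne_zero_iff.2 x.2
        simp [smul_smul, mul_inv_cancel₀ hx]
    _ = _ := by
        rw [lintegral_prod _ (by fun_prop)]
        refine lintegral_congr fun θ => ?_
        rw [Measure.volumeIoiPow, lintegral_withDensity_eq_lintegral_mul₀ (by fun_prop)
          (by fun_prop), ← lintegral_subtype_comap measurableSet_Ioi]
        rfl

theorem lintegral_fun_norm {F : ℝ → ℝ≥0∞} (hF : Measurable F) :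
    ∫⁻ x, F ‖x‖ ∂μ = μ.toSphere Set.univ *
      ∫⁻ r in Set.Ioi (0 : ℝ), ENNReal.ofReal (r ^ (Module.finrank ℝ E - 1)) * F r := by
  rw [lintegral_polar μ (F := fun x => F ‖x‖) (hF.comp measurable_norm), mul_comm, ← lintegral_const]
  refine lintegral_congr fun θ => setLIntegral_congr_fun measurableSet_Ioi fun r hr => ?_
  have hr' : (0 : ℝ) < r := hr
  simp [norm_smul, abs_of_pos hr']

theorem lintegral_ball_norm_rpow {α ρ : ℝ} (hα : 0 < Module.finrank ℝ E + α) (hρ : 0 < ρ) :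
    ∫⁻ x in {x : E | ‖x‖ < ρ}, ENNReal.ofReal (‖x‖ ^ α) ∂μ = μ.toSphere Set.univ *
      ENNReal.ofReal (ρ ^ (Module.finrank ℝ E + α) / (Module.finrank ℝ E + α)) := by
  have hms : MeasurableSet {x : E | ‖x‖ < ρ} := measurableSet_lt measurable_norm measurable_const
  have h1 : ∫⁻ x in {x : E | ‖x‖ < ρ}, ENNReal.ofReal (‖x‖ ^ α) ∂μ =
      ∫⁻ x, (Set.Iio ρ).indicator (fun r => ENNReal.ofReal (r ^ α)) ‖x‖ ∂μ := by
    rw [← lintegral_indicator hms]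
    rfl
  rw [h1, lintegral_fun_norm μ ((by fun_prop : Measurable fun r : ℝ =>
    ENNReal.ofReal (r ^ α)).indicator measurableSet_Iio)]
  congr 1
  have hn : 1 ≤ Module.finrank ℝ E := Module.finrank_pos
  have hi : IntervalIntegrable (fun r : ℝ => r ^ ((Module.finrank ℝ E : ℝ) + α - 1)) volume 0 ρ :=
    intervalIntegral.intervalIntegrable_rpow' (by linarith)
  have h2 : ∫⁻ r in Set.Ioi (0 : ℝ), ENNReal.ofReal (r ^ (Module.finrank ℝ E - 1)) *
      (Set.Iio ρ).indicator (fun r => ENNReal.ofReal (r ^ α)) r =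
      ∫⁻ r in Set.Ioc 0 ρ, ENNReal.ofReal (r ^ ((Module.finrank ℝ E : ℝ) + α - 1)) := by
    rw [setLIntegral_congr (Ioo_ae_eq_Ioc (a := (0 : ℝ)) (b := ρ)).symm, ← Set.Ioi_inter_Iio,
      Set.inter_comm, ← Measure.restrict_restrict measurableSet_Iio,
      ← lintegral_indicator measurableSet_Iio]
    refine setLIntegral_congr_fun measurableSet_Ioi fun r hr => ?_
    have hr' : (0 : ℝ) < r := hr
    by_cases hrρ : r < ρ
    · simp only [Set.indicator, Set.mem_Iio, hrρ, if_true]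
      rw [← ENNReal.ofReal_mul (by positivity), ← Real.rpow_natCast, ← Real.rpow_add hr']
      push_cast [hn]
      congr 2; ring
    · simp [Set.indicator, hrρ]
  rw [h2, ← ofReal_integral_eq_lintegral_ofReal hi.1 (by
    filter_upwards [ae_restrict_mem measurableSet_Ioc] with r hr
    exact Real.rpow_nonneg hr.1.le _), ← intervalIntegral.integral_of_le hρ.le,
    integral_rpow (Or.inl (by linarith)), sub_add_cancel, Real.zero_rpow hα.ne', sub_zero]

theorem lintegral_compl_ball_norm_rpow {α ρ : ℝ} (hα : Module.finrank ℝ E + α < 0) (hρ : 0 < ρ) :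
    ∫⁻ x in {x : E | ρ < ‖x‖}, ENNReal.ofReal (‖x‖ ^ α) ∂μ = μ.toSphere Set.univ *
      ENNReal.ofReal (ρ ^ (Module.finrank ℝ E + α) / (-(Module.finrank ℝ E + α))) := by
  have hms : MeasurableSet {x : E | ρ < ‖x‖} := measurableSet_lt measurable_const measurable_norm
  have h1 : ∫⁻ x in {x : E | ρ < ‖x‖}, ENNReal.ofReal (‖x‖ ^ α) ∂μ =
      ∫⁻ x, (Set.Ioi ρ).indicator (fun r => ENNReal.ofReal (r ^ α)) ‖x‖ ∂μ := by
    rw [← lintegral_indicator hms]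
    rfl
  rw [h1, lintegral_fun_norm μ ((by fun_prop : Measurable fun r : ℝ =>
    ENNReal.ofReal (r ^ α)).indicator measurableSet_Ioi)]
  congr 1
  have hn : 1 ≤ Module.finrank ℝ E := Module.finrank_pos
  have h2 : ∫⁻ r in Set.Ioi (0 : ℝ), ENNReal.ofReal (r ^ (Module.finrank ℝ E - 1)) *
      (Set.Ioi ρ).indicator (fun r => ENNReal.ofReal (r ^ α)) r =
      ∫⁻ r in Set.Ioi ρ, ENNReal.ofReal (r ^ ((Module.finrank ℝ E : ℝ) + α - 1)) := by
    rw [show Set.Ioi ρ = Set.Ioi ρ ∩ Set.Ioi 0 by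
      rw [Set.Ioi_inter_Ioi, max_eq_left hρ.le], ← Measure.restrict_restrict (measurableSet_Ioi (a := ρ)),
      ← lintegral_indicator (measurableSet_Ioi (a := ρ)), Set.Ioi_inter_Ioi, max_eq_left hρ.le]
    refine setLIntegral_congr_fun measurableSet_Ioi fun r hr => ?_
    have hr' : (0 : ℝ) < r := hr
    by_cases hrρ : ρ < r
    · simp only [Set.indicator, Set.mem_Ioi, hrρ, if_true]
      rw [← ENNReal.ofReal_mul (by positivity), ← Real.rpow_natCast, ← Real.rpow_add hr']
      push_cast [hn]
      congr 2; ring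
    · simp [Set.indicator, hrρ]
  rw [h2, ← ofReal_integral_eq_lintegral_ofReal
    (integrableOn_Ioi_rpow_of_lt (by linarith) hρ) (by
    filter_upwards [ae_restrict_mem measurableSet_Ioi] with r hr
    exact Real.rpow_nonneg (hρ.trans hr).le _),
    integral_Ioi_rpow_of_lt (by linarith) hρ, sub_add_cancel, div_neg, neg_div]

end Polar

/-- The Cauchy-Schwarz inequality with a scalar weight. -/
theorem lintegral_mul_le_sqrt_mul_eLpNorm {α G : Type*} [MeasurableSpace α] [NormedAddCommGroup G]
    {μ : Measure α} {w : α → ℝ} {g : α → G} (hw : Measurable w)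
    (hg : AEStronglyMeasurable g μ) :
    ∫⁻ x, ENNReal.ofReal (w x) * ‖g x‖ₑ ∂μ ≤
      (∫⁻ x, ENNReal.ofReal (w x) ^ 2 ∂μ) ^ (1 / 2 : ℝ) * eLpNorm g 2 μ := by
  have h := ENNReal.lintegral_mul_le_Lp_mul_Lq μ (p := 2) (q := 2)
    Real.HolderConjugate.two_two (f := fun x => ENNReal.ofReal (w x)) (g := fun x => ‖g x‖ₑ)
    (by fun_prop) hg.enorm
  rw [eLpNorm_eq_lintegral_rpow_enorm_toReal (by norm_num) (by norm_num)]
  simpa using h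

/-! ### Fourier estimates for Schwartz functions -/

section Schwartz

variable {d : ℕ}

theorem norm_rpow_smul_fourier (s : ℝ) (f : 𝓢(EuclideanSpace ℝ (Fin d), ℂ))
    (ξ : EuclideanSpace ℝ (Fin d)) :
    ‖((2 * Real.pi * ‖ξ‖) ^ s : ℝ) • 𝓕 f ξ‖ = (2 * Real.pi * ‖ξ‖) ^ s * ‖𝓕 f ξ‖ := by
  rw [norm_smul, Real.norm_eq_abs, abs_of_nonneg (by positivity)]

theorem norm_le_two_pi_mul (ξ : EuclideanSpace ℝ (Fin d)) : ‖ξ‖ ≤ 2 * Real.pi * ‖ξ‖ := by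
  have := Real.pi_gt_three
  nlinarith [norm_nonneg ξ]

/-- Low frequencies: Cauchy-Schwarz against `|ξ| ^ (-s)`, which is square integrable near `0`
because `2 s < d`. -/
theorem lintegral_ball_fourier_le [Nonempty (Fin d)] {s : ℝ} (hs0 : 0 ≤ s)
    (hs : 2 * s < d) {ρ : ℝ} (hρ : 0 < ρ) (f : 𝓢(EuclideanSpace ℝ (Fin d), ℂ)) :
    ∫⁻ ξ in {ξ : EuclideanSpace ℝ (Fin d) | ‖ξ‖ < ρ}, ‖𝓕 f ξ‖ₑ ≤
      ((volume : Measure (EuclideanSpace ℝ (Fin d))).toSphere Set.univ *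
        ENNReal.ofReal (ρ ^ (d - 2 * s) / (d - 2 * s))) ^ (1 / 2 : ℝ) * homSobolevNorm d s f := by
  have hfin : (Module.finrank ℝ (EuclideanSpace ℝ (Fin d)) : ℝ) = d := by simp
  have h1 := lintegral_ball_norm_rpow (volume : Measure (EuclideanSpace ℝ (Fin d)))
    (α := -(2 * s)) (ρ := ρ) (by rw [hfin]; linarith) hρ
  rw [hfin, ← sub_eq_add_neg] at h1
  rw [← h1]
  have hsm : AEStronglyMeasurable (fun ξ : EuclideanSpace ℝ (Fin d) =>
      ((2 * Real.pi * ‖ξ‖) ^ s : ℝ) • 𝓕 f ξ) volume := by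
    have : Continuous (𝓕 f : 𝓢(EuclideanSpace ℝ (Fin d), ℂ)) := (𝓕 f).continuous
    have h2 : Continuous fun ξ : EuclideanSpace ℝ (Fin d) => (2 * Real.pi * ‖ξ‖) ^ s :=
      (by fun_prop : Continuous fun ξ : EuclideanSpace ℝ (Fin d) =>
        2 * Real.pi * ‖ξ‖).rpow_const fun _ => Or.inr hs0
    exact (h2.smul this).aestronglyMeasurable
  calc ∫⁻ ξ in {ξ : EuclideanSpace ℝ (Fin d) | ‖ξ‖ < ρ}, ‖𝓕 f ξ‖ₑ
      ≤ ∫⁻ ξ in {ξ : EuclideanSpace ℝ (Fin d) | ‖ξ‖ < ρ},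
          ENNReal.ofReal (‖ξ‖ ^ (-s)) * ‖((2 * Real.pi * ‖ξ‖) ^ s : ℝ) • 𝓕 f ξ‖ₑ := by
        refine lintegral_mono_ae (ae_restrict_of_ae ?_)
        have h0 : ∀ᵐ ξ : EuclideanSpace ℝ (Fin d), ξ ≠ 0 := by
          simp [ae_iff]
        filter_upwards [h0] with ξ hξ
        have hξ' : 0 < ‖ξ‖ := norm_pos_iff.2 hξ
        rw [← ofReal_norm, ← ofReal_norm, ← ENNReal.ofReal_mul (by positivity),
          norm_rpow_smul_fourier]
        apply ENNReal.ofReal_le_ofReal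
        rw [← mul_assoc]
        refine le_mul_of_one_le_left (norm_nonneg _) ?_
        rw [Real.rpow_neg hξ'.le, ← div_eq_inv_mul, one_le_div (by positivity)]
        exact Real.rpow_le_rpow hξ'.le (norm_le_two_pi_mul ξ) hs0
    _ ≤ _ := lintegral_mul_le_sqrt_mul_eLpNorm (by fun_prop) hsm.restrict
    _ ≤ _ := by
        refine mul_le_mul' (ENNReal.rpow_le_rpow ?_ (by norm_num)) (eLpNorm_restrict_le _ _ _ _)
        refine le_of_eq (lintegral_congr fun ξ => ?_)
        rw [← ENNReal.ofReal_pow (by positivity), ← Real.rpow_mul_natCast (norm_nonneg _)]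
        congr 2
        push_cast
        ring

theorem enorm_fourierInv_le (f : 𝓢(EuclideanSpace ℝ (Fin d), ℂ)) (x : EuclideanSpace ℝ (Fin d)) :
    ‖(𝓕⁻ f : 𝓢(EuclideanSpace ℝ (Fin d), ℂ)) x‖ₑ ≤ ∫⁻ ξ, ‖f ξ‖ₑ := by
  rw [SchwartzMap.fourierInv_coe, Real.fourierInv_eq]
  refine (enorm_integral_le_lintegral_enorm _).trans (le_of_eq (lintegral_congr fun ξ => ?_))
  rw [← ofReal_norm, ← ofReal_norm, Circle.norm_smul]

/-- Plancherel's theorem for Schwartz functions, for the extended norm. -/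
theorem eLpNorm_fourier (f : 𝓢(EuclideanSpace ℝ (Fin d), ℂ)) :
    eLpNorm (𝓕 f : 𝓢(EuclideanSpace ℝ (Fin d), ℂ)) 2 volume = eLpNorm f 2 volume := by
  have h := SchwartzMap.norm_fourier_toL2_eq f
  rw [SchwartzMap.norm_toLp, SchwartzMap.norm_toLp] at h
  exact (ENNReal.toReal_eq_toReal_iff' ((𝓕 f).memLp 2 volume).eLpNorm_ne_top
    (f.memLp 2 volume).eLpNorm_ne_top).1 h

/-- High frequencies: for `s ≥ 1` and `|ξ| ≥ R` one has `|ξ| ≤ R ^ (1-s) |ξ| ^ s`. -/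
theorem eLpNorm_lineDeriv_le {s R : ℝ} (hs : 1 ≤ s) (hR : 0 < R)
    (f g : 𝓢(EuclideanSpace ℝ (Fin d), ℂ))
    (hg0 : ∀ ξ, ‖ξ‖ ≤ R → 𝓕 g ξ = 0) (hg : ∀ ξ, ‖𝓕 g ξ‖ ≤ ‖𝓕 f ξ‖)
    (e : EuclideanSpace ℝ (Fin d)) (he : ‖e‖ ≤ 1) :
    eLpNorm (LineDeriv.lineDerivOp e g : 𝓢(EuclideanSpace ℝ (Fin d), ℂ)) 2 volume ≤
      ENNReal.ofReal (R ^ (1 - s)) * homSobolevNorm d s f := by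
  rw [← eLpNorm_fourier]
  refine eLpNorm_le_mul_eLpNorm_of_ae_le_mul (ae_of_all _ fun ξ => ?_) 2
  have htg : (fun x : EuclideanSpace ℝ (Fin d) => ⟪x, e⟫_ℝ).HasTemperateGrowth := by fun_prop
  rw [SchwartzMap.fourier_lineDerivOp_eq, smul_apply,
    SchwartzMap.smulLeftCLM_apply_apply htg, norm_rpow_smul_fourier, norm_smul, norm_smul]
  have h2 : ‖(2 * (Real.pi : ℂ) * Complex.I)‖ = 2 * Real.pi := by
    simp [abs_of_pos Real.pi_pos]
  rw [h2]
  by_cases hξ : ‖ξ‖ ≤ R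
  · rw [hg0 ξ hξ, norm_zero, mul_zero, mul_zero]
    positivity
  · push Not at hξ
    have hξ0 : 0 < ‖ξ‖ := hR.trans hξ
    have hin : ‖⟪ξ, e⟫_ℝ‖ ≤ ‖ξ‖ := (norm_inner_le_norm ξ e).trans
      (mul_le_of_le_one_right hξ0.le he)
    have hpow : 2 * Real.pi * ‖ξ‖ ≤ R ^ (1 - s) * (2 * Real.pi * ‖ξ‖) ^ s := by
      have h3 : (2 * Real.pi * ‖ξ‖) ^ (1 - s) ≤ R ^ (1 - s) :=
        Real.rpow_le_rpow_of_nonpos hR (hξ.le.trans (norm_le_two_pi_mul ξ)) (by linarith)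
      calc 2 * Real.pi * ‖ξ‖ = (2 * Real.pi * ‖ξ‖) ^ (1 - s) * (2 * Real.pi * ‖ξ‖) ^ s := by
            rw [← Real.rpow_add (by positivity)]; simp
        _ ≤ _ := by gcongr
    calc 2 * Real.pi * (‖⟪ξ, e⟫_ℝ‖ * ‖𝓕 g ξ‖) ≤ 2 * Real.pi * (‖ξ‖ * ‖𝓕 f ξ‖) := by
          gcongr
          exact hg ξ
      _ = 2 * Real.pi * ‖ξ‖ * ‖𝓕 f ξ‖ := by ring
      _ ≤ R ^ (1 - s) * (2 * Real.pi * ‖ξ‖) ^ s * ‖𝓕 f ξ‖ := by gcongr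
      _ = _ := by ring

/-- A Schwartz function is recovered from its gradient by integrating along a ray from infinity. -/
theorem enorm_le_lintegral_ray (g : 𝓢(EuclideanSpace ℝ (Fin d), ℂ)) {θ : EuclideanSpace ℝ (Fin d)}
    (hθ : ‖θ‖ = 1) (r : ℝ) :
    ‖g (r • θ)‖ₑ ≤ ∑ i, ∫⁻ t in Set.Ioi r,
      ‖LineDeriv.lineDerivOp (EuclideanSpace.basisFun (Fin d) ℝ i) g (t • θ)‖ₑ := by
  set D : ℝ → ℂ := fun t => ∑ i, θ i • LineDeriv.lineDerivOp (EuclideanSpace.basisFun (Fin d) ℝ i) g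
    (t • θ) with hD
  have hderiv : ∀ t, HasDerivAt (fun t : ℝ => g (t • θ)) (D t) t := by
    intro t
    have h1 : HasDerivAt (fun t : ℝ => t • θ) θ t := by
      simpa using (hasDerivAt_id t).smul_const θ
    have h2 := (g.differentiableAt (x := t • θ)).hasFDerivAt.comp_hasDerivAt t h1
    refine h2.congr_deriv ?_
    rw [show fderiv ℝ g (t • θ) θ = fderiv ℝ g (t • θ)
      (∑ i, (EuclideanSpace.basisFun (Fin d) ℝ).repr θ i • EuclideanSpace.basisFun (Fin d) ℝ i) by
        rw [(EuclideanSpace.basisFun (Fin d) ℝ).sum_repr θ]]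
    simp only [map_sum, map_smul, hD, SchwartzMap.lineDerivOp_apply_eq_fderiv,
      EuclideanSpace.basisFun_repr]
  have hle : ∫⁻ t in Set.Ioi r, ‖D t‖ₑ ≤ ∑ i, ∫⁻ t in Set.Ioi r,
      ‖LineDeriv.lineDerivOp (EuclideanSpace.basisFun (Fin d) ℝ i) g (t • θ)‖ₑ := by
    rw [← lintegral_finsetSum]
    · refine lintegral_mono fun t => (enorm_sum_le _ _).trans (Finset.sum_le_sum fun i _ => ?_)
      rw [enorm_smul]
      refine mul_le_of_le_one_left' ?_
      rw [← ofReal_norm, ENNReal.ofReal_le_one]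
      exact (PiLp.norm_apply_le θ i).trans hθ.le
    · intro i _
      have h1 := (LineDeriv.lineDerivOp (EuclideanSpace.basisFun (Fin d) ℝ i) g).continuous
      have h2 : Continuous fun t : ℝ => t • θ := by fun_prop
      exact (h1.comp h2).enorm.measurable
  refine le_trans ?_ hle
  by_cases htop : ∫⁻ t in Set.Ioi r, ‖D t‖ₑ = ⊤
  · rw [htop]; exact le_top
  have hDc : Continuous D := by
    have : ∀ i, Continuous (LineDeriv.lineDerivOp (EuclideanSpace.basisFun (Fin d) ℝ i) g) :=
      fun i => SchwartzMap.continuous _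
    have h2 : Continuous fun t : ℝ => t • θ := by fun_prop
    exact continuous_finsetSum _ fun i _ => ((this i).comp h2).const_smul (θ i)
  have hint : IntegrableOn D (Set.Ioi r) :=
    ⟨hDc.aestronglyMeasurable, lt_top_iff_ne_top.2 htop⟩
  have htend : Tendsto (fun t : ℝ => g (t • θ)) atTop (𝓝 0) := by
    have h1 : Tendsto (fun t : ℝ => t • θ) atTop (cocompact _) := by
      rw [← Metric.cobounded_eq_cocompact, ← tendsto_norm_atTop_iff_cobounded]
      simpa [norm_smul, hθ] using tendsto_abs_atTop_atTop
    exact g.toZeroAtInfty.zero_at_infty'.comp h1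
  have h := integral_Ioi_of_hasDerivAt_of_tendsto' (fun t _ => hderiv t) hint htend
  rw [zero_sub] at h
  rw [← enorm_neg, ← h]
  exact enorm_integral_le_lintegral_enorm _

end Schwartz

/-! ### Spherical means and the homogeneous Sobolev norm -/

section Sphere

variable {d : ℕ}

/-- Integrating over rays issued from a sphere is integrating over the exterior of the ball with
weight `|x| ^ (1-d)`. -/
theorem lintegral_sphere_ray_eq [Nonempty (Fin d)] {G : EuclideanSpace ℝ (Fin d) → ℝ≥0∞}
    (hG : Measurable G) {r : ℝ} (hr : 0 < r) :
    ∫⁻ θ, (∫⁻ t in Set.Ioi r, G (t • (θ : EuclideanSpace ℝ (Fin d))))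
        ∂(volume : Measure (EuclideanSpace ℝ (Fin d))).toSphere =
      ∫⁻ x in {x : EuclideanSpace ℝ (Fin d) | r < ‖x‖},
        ENNReal.ofReal (‖x‖ ^ (1 - d : ℝ)) * G x := by
  have hd : 1 ≤ d := Fin.pos_iff_nonempty.2 inferInstance
  have hms : MeasurableSet {x : EuclideanSpace ℝ (Fin d) | r < ‖x‖} :=
    measurableSet_lt measurable_const measurable_norm
  rw [← lintegral_indicator hms,
    lintegral_polar (volume : Measure (EuclideanSpace ℝ (Fin d))) (by
      refine Measurable.indicator ?_ hms
      fun_prop)]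
  refine lintegral_congr fun θ => ?_
  have hθ : ‖(θ : EuclideanSpace ℝ (Fin d))‖ = 1 := by simp
  rw [show Set.Ioi r = Set.Ioi r ∩ Set.Ioi 0 by rw [Set.Ioi_inter_Ioi, max_eq_left hr.le],
    ← Measure.restrict_restrict (measurableSet_Ioi (a := r)),
    ← lintegral_indicator (measurableSet_Ioi (a := r))]
  refine setLIntegral_congr_fun measurableSet_Ioi fun t ht => ?_
  have ht' : (0 : ℝ) < t := ht
  have hn : ‖t • (θ : EuclideanSpace ℝ (Fin d))‖ = t := by
    rw [norm_smul, hθ, mul_one, Real.norm_of_nonneg ht'.le]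
  by_cases hrt : r < t
  · simp only [Set.indicator, Set.mem_Ioi, hrt, if_true, Set.mem_ofPred_eq, hn]
    rw [← mul_assoc, ← ENNReal.ofReal_mul (by positivity), ← Real.rpow_natCast,
      ← Real.rpow_add ht']
    simp [hd]
  · simp [Set.indicator, hrt, hn]

/-- Spherical means are bounded by the gradient in `L ^ 2`, as `|x| ^ (1-d)` is square integrable
outside a ball when `d > 2`. -/
theorem lintegral_sphere_le_gradient [Nonempty (Fin d)] (hd : 2 < d)
    (g : 𝓢(EuclideanSpace ℝ (Fin d), ℂ)) {r : ℝ} (hr : 0 < r) :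
    ∫⁻ θ, ‖g (r • (θ : EuclideanSpace ℝ (Fin d)))‖ₑ
        ∂(volume : Measure (EuclideanSpace ℝ (Fin d))).toSphere ≤
      ∑ i, ((volume : Measure (EuclideanSpace ℝ (Fin d))).toSphere Set.univ *
          ENNReal.ofReal (r ^ (2 - d : ℝ) / (d - 2))) ^ (1 / 2 : ℝ) *
        eLpNorm (LineDeriv.lineDerivOp (EuclideanSpace.basisFun (Fin d) ℝ i) g :
          𝓢(EuclideanSpace ℝ (Fin d), ℂ)) 2 volume := by
  have hfin : (Module.finrank ℝ (EuclideanSpace ℝ (Fin d)) : ℝ) = d := by simp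
  have hd' : (2 : ℝ) < d := by exact_mod_cast hd
  have hout := lintegral_compl_ball_norm_rpow (volume : Measure (EuclideanSpace ℝ (Fin d)))
    (α := 2 - 2 * d) (by rw [hfin]; linarith) hr
  rw [hfin, show (d : ℝ) + (2 - 2 * d) = 2 - d by ring, neg_sub] at hout
  have hc : ∀ i, Continuous (LineDeriv.lineDerivOp (EuclideanSpace.basisFun (Fin d) ℝ i) g) :=
    fun i => SchwartzMap.continuous _
  have hm : ∀ i, Measurable fun x => ‖LineDeriv.lineDerivOp
      (EuclideanSpace.basisFun (Fin d) ℝ i) g x‖ₑ := fun i => (hc i).enorm.measurable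
  calc _ ≤ ∫⁻ θ, (∑ i, ∫⁻ t in Set.Ioi r,
        ‖LineDeriv.lineDerivOp (EuclideanSpace.basisFun (Fin d) ℝ i) g
          (t • (θ : EuclideanSpace ℝ (Fin d)))‖ₑ)
          ∂(volume : Measure (EuclideanSpace ℝ (Fin d))).toSphere :=
        lintegral_mono fun θ => enorm_le_lintegral_ray g (by simp) r
    _ = ∑ i, ∫⁻ θ, (∫⁻ t in Set.Ioi r,
        ‖LineDeriv.lineDerivOp (EuclideanSpace.basisFun (Fin d) ℝ i) g
          (t • (θ : EuclideanSpace ℝ (Fin d)))‖ₑ)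
          ∂(volume : Measure (EuclideanSpace ℝ (Fin d))).toSphere := by
        refine lintegral_finsetSum _ fun i _ => ?_
        refine Measurable.lintegral_prod_right' (f := fun q :
          (Metric.sphere (0 : EuclideanSpace ℝ (Fin d)) 1) × ℝ =>
          ‖LineDeriv.lineDerivOp (EuclideanSpace.basisFun (Fin d) ℝ i) g
          (q.2 • (q.1 : EuclideanSpace ℝ (Fin d)))‖ₑ) ?_
        exact (hm i).comp (by fun_prop)
    _ ≤ _ := by
        refine Finset.sum_le_sum fun i _ => ?_
        rw [lintegral_sphere_ray_eq (hm i) hr]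
        refine (lintegral_mul_le_sqrt_mul_eLpNorm (by fun_prop)
          (hc i).aestronglyMeasurable).trans ?_
        rw [← hout]
        refine mul_le_mul' (ENNReal.rpow_le_rpow ?_ (by norm_num)) (eLpNorm_restrict_le _ _ _ _)
        refine le_of_eq (lintegral_congr fun x => ?_)
        rw [← ENNReal.ofReal_pow (by positivity), ← Real.rpow_mul_natCast (norm_nonneg _)]
        congr 2
        push_cast
        ring

/-- Smooth splitting of a Schwartz function into frequencies below `2 R` and above `R`. -/
theorem exists_frequency_splitting {R : ℝ} (hR : 0 < R) (f : 𝓢(EuclideanSpace ℝ (Fin d), ℂ)) :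
    ∃ f₀ g : 𝓢(EuclideanSpace ℝ (Fin d), ℂ), f = f₀ + g ∧
      (∀ x, ‖f₀ x‖ₑ ≤ ∫⁻ ξ in {ξ : EuclideanSpace ℝ (Fin d) | ‖ξ‖ < 2 * R}, ‖𝓕 f ξ‖ₑ) ∧
      (∀ ξ, ‖ξ‖ ≤ R → 𝓕 g ξ = 0) ∧ ∀ ξ, ‖𝓕 g ξ‖ ≤ ‖𝓕 f ξ‖ := by
  set χ : ContDiffBump (0 : EuclideanSpace ℝ (Fin d)) := ⟨R, 2 * R, hR, by linarith⟩ with hχ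
  have htg : (χ : EuclideanSpace ℝ (Fin d) → ℝ).HasTemperateGrowth := by
    have h := (χ.hasCompactSupport.toSchwartzMap χ.contDiff).hasTemperateGrowth
    exact h
  have hF₀ : ∀ ξ, SchwartzMap.smulLeftCLM ℂ χ (𝓕 f) ξ = χ ξ • 𝓕 f ξ := fun ξ =>
    SchwartzMap.smulLeftCLM_apply_apply htg _ ξ
  set f₀ : 𝓢(EuclideanSpace ℝ (Fin d), ℂ) := 𝓕⁻ (SchwartzMap.smulLeftCLM ℂ χ (𝓕 f)) with hf₀
  have hFg : ∀ ξ, 𝓕 (f - f₀) ξ = (1 - χ ξ) • 𝓕 f ξ := by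
    intro ξ
    have h1 : 𝓕 (f - f₀) = 𝓕 f - SchwartzMap.smulLeftCLM ℂ χ (𝓕 f) := by
      rw [sub_eq_add_neg, FourierTransform.fourier_add, FourierTransform.fourier_neg, ← sub_eq_add_neg, hf₀, FourierTransform.fourier_fourierInv_eq]
    rw [h1, sub_apply, hF₀, sub_smul, one_smul]
  refine ⟨f₀, f - f₀, by abel, fun x => ?_, fun ξ hξ => ?_, fun ξ => ?_⟩
  · refine (enorm_fourierInv_le _ x).trans ?_
    rw [← lintegral_indicator (measurableSet_lt measurable_norm measurable_const)]
    refine lintegral_mono fun ξ => ?_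
    rw [hF₀]
    by_cases hξ : ‖ξ‖ < 2 * R
    · simp only [Set.indicator, Set.mem_ofPred_eq, hξ, if_true]
      rw [enorm_smul]
      refine mul_le_of_le_one_left' ?_
      rw [← ofReal_norm, ENNReal.ofReal_le_one, Real.norm_of_nonneg χ.nonneg]
      exact χ.le_one
    · rw [χ.zero_of_le_dist (by simpa [hχ] using hξ)]
      simp
  · rw [hFg, χ.one_of_mem_closedBall (by simpa [hχ] using hξ)]
    simp
  · rw [hFg, norm_smul, Real.norm_of_nonneg (by linarith [χ.le_one (x := ξ)])]
    exact mul_le_of_le_one_left (norm_nonneg _) (by linarith [χ.nonneg (x := ξ)])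

/-- Scale-invariant bound for spherical means: frequencies below and above `1 / r` contribute the
same power `r ^ (s - d/2)`. The measure on the sphere is not normalized. -/
theorem exists_sphere_bound {s : ℝ} (hs1 : 1 ≤ s) (hs : 2 * s < d) :
    ∃ C : ℝ≥0∞, C ≠ ⊤ ∧ ∀ (f : 𝓢(EuclideanSpace ℝ (Fin d), ℂ)) (r : ℝ), 0 < r →
      ∫⁻ θ, ‖f (r • (θ : EuclideanSpace ℝ (Fin d)))‖ₑ
          ∂(volume : Measure (EuclideanSpace ℝ (Fin d))).toSphere ≤
        C * ENNReal.ofReal (r ^ (s - d / 2)) * homSobolevNorm d s f := by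
  have hd' : (2 : ℝ) < d := by linarith
  have hd : 2 < d := by exact_mod_cast hd'
  have : Nonempty (Fin d) := ⟨⟨0, by omega⟩⟩
  set S := (volume : Measure (EuclideanSpace ℝ (Fin d))).toSphere Set.univ with hS
  have hStop : S ≠ ⊤ := measure_ne_top _ _
  have hδ : 0 < d - 2 * s := by linarith
  have hsqrt : ∀ x : ℝ, (S * ENNReal.ofReal x) ^ (1 / 2 : ℝ) ≠ ⊤ := fun x =>
    ENNReal.rpow_ne_top_of_nonneg (by norm_num) (ENNReal.mul_ne_top hStop ENNReal.ofReal_ne_top)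
  refine ⟨S * (S * ENNReal.ofReal (2 ^ (d - 2 * s) / (d - 2 * s))) ^ (1 / 2 : ℝ) +
    d * (S * ENNReal.ofReal (1 / (d - 2))) ^ (1 / 2 : ℝ), ?_, fun f r hr => ?_⟩
  · exact ENNReal.add_ne_top.2 ⟨ENNReal.mul_ne_top hStop (hsqrt _),
      ENNReal.mul_ne_top (ENNReal.natCast_ne_top d) (hsqrt _)⟩
  have hR : 0 < r⁻¹ := inv_pos.2 hr
  obtain ⟨f₀, g, hfg, hlow, hg0, hg⟩ := exists_frequency_splitting hR f
  have hhalf : ∀ c α : ℝ, (S * ENNReal.ofReal (r ^ α * c)) ^ (1 / 2 : ℝ) =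
      (S * ENNReal.ofReal c) ^ (1 / 2 : ℝ) * ENNReal.ofReal (r ^ (α / 2)) := by
    intro c α
    rw [ENNReal.ofReal_mul (by positivity), mul_comm (ENNReal.ofReal (r ^ α)), ← mul_assoc,
      ENNReal.mul_rpow_of_nonneg _ _ (by norm_num : (0 : ℝ) ≤ 1 / 2)]
    congr 1
    rw [ENNReal.ofReal_rpow_of_pos (by positivity), ← Real.rpow_mul hr.le]
    congr 2
    ring
  have hL : ∫⁻ θ, ‖f₀ (r • (θ : EuclideanSpace ℝ (Fin d)))‖ₑ
      ∂(volume : Measure (EuclideanSpace ℝ (Fin d))).toSphere ≤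
      S * (S * ENNReal.ofReal (2 ^ (d - 2 * s) / (d - 2 * s))) ^ (1 / 2 : ℝ) *
        ENNReal.ofReal (r ^ (s - d / 2)) * homSobolevNorm d s f := by
    calc _ ≤ ∫⁻ _, (∫⁻ ξ in {ξ : EuclideanSpace ℝ (Fin d) | ‖ξ‖ < 2 * r⁻¹}, ‖𝓕 f ξ‖ₑ)
          ∂(volume : Measure (EuclideanSpace ℝ (Fin d))).toSphere :=
          lintegral_mono fun θ => hlow _
      _ = S * ∫⁻ ξ in {ξ : EuclideanSpace ℝ (Fin d) | ‖ξ‖ < 2 * r⁻¹}, ‖𝓕 f ξ‖ₑ := by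
          rw [lintegral_const, mul_comm]
      _ ≤ S * ((S * ENNReal.ofReal ((2 * r⁻¹) ^ (d - 2 * s) / (d - 2 * s))) ^ (1 / 2 : ℝ) *
            homSobolevNorm d s f) := by
          gcongr
          exact lintegral_ball_fourier_le (by linarith) hs (by positivity) f
      _ = _ := by
          rw [show (2 * r⁻¹) ^ (d - 2 * s) / (d - 2 * s) =
            r ^ (-(d - 2 * s)) * (2 ^ (d - 2 * s) / (d - 2 * s)) by
              rw [Real.mul_rpow (by norm_num) hR.le, Real.inv_rpow hr.le, Real.rpow_neg hr.le]
              ring, hhalf, show -(d - 2 * s) / 2 = s - d / 2 by ring]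
          ring
  have hH : ∫⁻ θ, ‖g (r • (θ : EuclideanSpace ℝ (Fin d)))‖ₑ
      ∂(volume : Measure (EuclideanSpace ℝ (Fin d))).toSphere ≤
      d * (S * ENNReal.ofReal (1 / (d - 2))) ^ (1 / 2 : ℝ) *
        ENNReal.ofReal (r ^ (s - d / 2)) * homSobolevNorm d s f := by
    refine (lintegral_sphere_le_gradient hd g hr).trans ?_
    calc _ ≤ ∑ _i : Fin d, (S * ENNReal.ofReal (r ^ (2 - d : ℝ) / (d - 2))) ^ (1 / 2 : ℝ) *
          (ENNReal.ofReal (r⁻¹ ^ (1 - s)) * homSobolevNorm d s f) := by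
          gcongr with i _
          exact eLpNorm_lineDeriv_le hs1 hR f g hg0 hg _ (by simp)
      _ = d * ((S * ENNReal.ofReal (1 / (d - 2))) ^ (1 / 2 : ℝ) *
          (ENNReal.ofReal (r ^ ((2 - d : ℝ) / 2)) * ENNReal.ofReal (r⁻¹ ^ (1 - s))) *
            homSobolevNorm d s f) := by
          rw [Finset.sum_const, Finset.card_univ, Fintype.card_fin, nsmul_eq_mul,
            show r ^ (2 - d : ℝ) / (d - 2) = r ^ (2 - d : ℝ) * (1 / (d - 2)) by ring, hhalf]
          ring
      _ = _ := by
          rw [← ENNReal.ofReal_mul (by positivity), Real.inv_rpow hr.le, ← Real.rpow_neg hr.le,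
            ← Real.rpow_add hr, show (2 - d : ℝ) / 2 + -(1 - s) = s - d / 2 by ring]
          ring
  calc _ ≤ ∫⁻ θ, (‖f₀ (r • (θ : EuclideanSpace ℝ (Fin d)))‖ₑ +
          ‖g (r • (θ : EuclideanSpace ℝ (Fin d)))‖ₑ)
          ∂(volume : Measure (EuclideanSpace ℝ (Fin d))).toSphere := by
        refine lintegral_mono fun θ => ?_
        rw [hfg]
        exact enorm_add_le _ _
    _ = _ := lintegral_add_left (by
        have := f₀.continuous
        exact (this.comp (by fun_prop)).enorm.measurable) _
    _ ≤ _ := add_le_add hL hH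
    _ = _ := by ring

end Sphere

/-! ### Radial functions in the homogeneous Sobolev space -/

section Radial

variable {d : ℕ}

/-- The pairing of a Schwartz function with a radial weight is controlled by its spherical means. -/
theorem enorm_integral_radial_smul_le [Nonempty (Fin d)] (f : 𝓢(EuclideanSpace ℝ (Fin d), ℂ))
    {ψ : ℝ → ℝ} (hψ : Continuous ψ) (hψ0 : ∀ r, 0 ≤ ψ r) :
    ‖∫ x : EuclideanSpace ℝ (Fin d), ψ ‖x‖ • f x‖ₑ ≤ ∫⁻ r in Set.Ioi (0 : ℝ),
      ENNReal.ofReal (r ^ (d - 1) * ψ r) * ∫⁻ θ, ‖f (r • (θ : EuclideanSpace ℝ (Fin d)))‖ₑ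
        ∂(volume : Measure (EuclideanSpace ℝ (Fin d))).toSphere := by
  have hfc := f.continuous
  have hF : Measurable fun x : EuclideanSpace ℝ (Fin d) => ‖ψ ‖x‖ • f x‖ₑ :=
    (by fun_prop : Continuous fun x : EuclideanSpace ℝ (Fin d) => ψ ‖x‖ • f x).enorm.measurable
  refine (enorm_integral_le_lintegral_enorm _).trans ?_
  rw [lintegral_polar (volume : Measure (EuclideanSpace ℝ (Fin d))) hF, lintegral_lintegral_swap]
  · refine le_of_eq (setLIntegral_congr_fun measurableSet_Ioi fun r hr => ?_)
    have hr' : (0 : ℝ) < r := hr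
    have hm : Measurable fun θ : Metric.sphere (0 : EuclideanSpace ℝ (Fin d)) 1 =>
        ‖f (r • (θ : EuclideanSpace ℝ (Fin d)))‖ₑ :=
      (hfc.comp (by fun_prop)).enorm.measurable
    rw [← lintegral_const_mul _ hm]
    refine lintegral_congr fun θ => ?_
    have hn : ‖r • (θ : EuclideanSpace ℝ (Fin d))‖ = r := by
      rw [norm_smul, Real.norm_of_nonneg hr'.le]; simp
    rw [hn, enorm_smul, ← mul_assoc, Real.enorm_eq_ofReal (hψ0 r),
      ← ENNReal.ofReal_mul (by positivity), finrank_euclideanSpace_fin]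
  · refine Measurable.aemeasurable ?_
    have h2 : Measurable fun q : (Metric.sphere (0 : EuclideanSpace ℝ (Fin d)) 1) × ℝ =>
        ‖ψ ‖q.2 • (q.1 : EuclideanSpace ℝ (Fin d))‖ •
          f (q.2 • (q.1 : EuclideanSpace ℝ (Fin d)))‖ₑ := hF.comp (by fun_prop)
    exact Measurable.mul (by fun_prop) h2

theorem contDiff_comp_norm_of_eventually_eq_zero {ψ : ℝ → ℝ} (hψ : ContDiff ℝ ∞ ψ)
    (h0 : ψ =ᶠ[𝓝 0] 0) : ContDiff ℝ ∞ fun x : EuclideanSpace ℝ (Fin d) => ψ ‖x‖ := by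
  rw [contDiff_iff_contDiffAt]
  intro x
  by_cases hx : x = 0
  · have h1 : Tendsto (fun x : EuclideanSpace ℝ (Fin d) => ‖x‖) (𝓝 x) (𝓝 0) := by
      rw [hx]; exact tendsto_norm_zero
    have h2 : (fun x : EuclideanSpace ℝ (Fin d) => ψ ‖x‖) =ᶠ[𝓝 x] fun _ => 0 :=
      h1.eventually h0
    exact contDiffAt_const.congr_of_eventuallyEq h2
  · exact hψ.contDiffAt.comp x (contDiffAt_norm ℝ hx)

theorem continuous_bump_mul {r₀ : ℝ} (ψ : ContDiffBump r₀) (hψ : ψ.rOut < r₀) {q : ℝ → ℝ}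
    (hq : ContinuousOn q (Set.Ioi 0)) : Continuous fun r => ψ r * q r := by
  refine (ψ.continuous.continuousOn.mul hq).continuous_of_tsupport_subset isOpen_Ioi ?_
  refine (tsupport_mul_subset_left (f := ψ) (g := q)).trans ?_
  rw [ψ.tsupport_eq]
  intro r hr
  rw [Metric.mem_closedBall, Real.dist_eq] at hr
  have := (abs_le.1 hr).1
  exact Set.mem_Ioi.2 (by linarith)

/-- A pointwise inequality between continuous functions on `(0, ∞)` may be tested on bumps. -/
theorem abs_le_of_forall_bump {n : ℕ} {z H : ℝ → ℝ} (hz : ContinuousOn z (Set.Ioi 0))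
    (hH : ContinuousOn H (Set.Ioi 0))
    (h : ∀ (r₀ : ℝ) (ψ : ContDiffBump r₀), ψ.rOut < r₀ →
      |∫ r in Set.Ioi (0 : ℝ), r ^ n * (ψ r * z r)| ≤
        ∫ r in Set.Ioi (0 : ℝ), r ^ n * (ψ r * H r)) :
    ∀ r, 0 < r → |z r| ≤ H r := by
  -- it suffices to bound `ε z` for both signs `ε`
  suffices key : ∀ ε : ℝ, |ε| = 1 → ∀ r, 0 < r → ε * z r ≤ H r by
    intro r hr
    have h1 := key 1 (by simp) r hr
    have h2 := key (-1) (by simp) r hr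
    exact abs_le.2 ⟨by linarith, by linarith⟩
  intro ε hε r₀ hr₀
  by_contra! hlt
  set g : ℝ → ℝ := fun r => ε * z r - H r with hg
  have hgc : ContinuousOn g (Set.Ioi 0) := (continuousOn_const.mul hz).sub hH
  have hgpos : ∀ᶠ r in 𝓝 r₀, 0 < g r :=
    (hgc.continuousAt (Ioi_mem_nhds hr₀)).eventually_const_lt (by simp only [hg]; linarith)
  obtain ⟨δ, hδ, hball⟩ := Metric.eventually_nhds_iff_ball.1 hgpos
  set ρ : ℝ := min δ r₀ / 2 with hρ
  have hmin : 0 < min δ r₀ := lt_min hδ hr₀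
  have hρ0 : 0 < ρ := by positivity
  have hρδ : ρ < δ := by linarith [min_le_left δ r₀]
  have hρr : ρ < r₀ := by linarith [min_le_right δ r₀]
  set ψ : ContDiffBump r₀ := ⟨ρ / 2, ρ, by positivity, by linarith⟩ with hψ
  have hψr : ψ.rOut < r₀ := hρr
  have hsupp : ∀ r, ψ r ≠ 0 → 0 < r ∧ 0 < g r := by
    intro r hr
    have h1 : r ∈ Metric.ball r₀ ρ := by
      have : r ∈ Function.support ψ := hr
      rwa [ψ.support_eq] at this
    have h2 : |r - r₀| < ρ := by rwa [Metric.mem_ball, Real.dist_eq] at h1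
    refine ⟨by linarith [(abs_lt.1 h2).1], hball r ?_⟩
    exact Metric.ball_subset_ball hρδ.le h1
  have hcont : ∀ q : ℝ → ℝ, ContinuousOn q (Set.Ioi 0) →
      Continuous fun r => r ^ n * (ψ r * q r) := fun q hq =>
    (continuous_pow n).mul (continuous_bump_mul ψ hψr hq)
  have hcomp : ∀ q : ℝ → ℝ, HasCompactSupport fun r => r ^ n * (ψ r * q r) := fun q =>
    (ψ.hasCompactSupport.mul_right (f' := q)).mul_left
  have hint : ∀ q : ℝ → ℝ, ContinuousOn q (Set.Ioi 0) →
      IntegrableOn (fun r => r ^ n * (ψ r * q r)) (Set.Ioi 0) := fun q hq =>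
    ((hcont q hq).integrable_of_hasCompactSupport (hcomp q)).integrableOn
  have hpos : 0 < ∫ r, r ^ n * (ψ r * g r) := by
    refine (hcont g hgc).integral_pos_of_hasCompactSupport_nonneg_nonzero (hcomp g) (x := r₀) ?_ ?_
    · intro r
      by_cases hr : ψ r = 0
      · simp [hr]
      · obtain ⟨h1, h2⟩ := hsupp r hr
        have h3 := ψ.nonneg (x := r)
        simp only [Pi.zero_apply]
        positivity
    · have h1 : ψ r₀ = 1 := ψ.one_of_mem_closedBall (by simp; positivity)
      have h2 : 0 < g r₀ := by simp only [hg]; linarith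
      rw [h1]
      positivity
  rw [← setIntegral_eq_integral_of_forall_compl_eq_zero (s := Set.Ioi 0) (by
    intro r hr
    by_cases h0 : ψ r = 0
    · simp [h0]
    · exact absurd (hsupp r h0).1 hr)] at hpos
  have hsplit : ∫ r in Set.Ioi (0 : ℝ), r ^ n * (ψ r * g r) =
      ε * (∫ r in Set.Ioi (0 : ℝ), r ^ n * (ψ r * z r)) -
        ∫ r in Set.Ioi (0 : ℝ), r ^ n * (ψ r * H r) := by
    rw [← integral_const_mul, ← integral_sub ((hint z hz).const_mul ε) (hint H hH)]
    congr 1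
    ext r
    simp only [hg]
    ring
  have h1 := h r₀ ψ hψr
  have h2 : ε * (∫ r in Set.Ioi (0 : ℝ), r ^ n * (ψ r * z r)) ≤
      |∫ r in Set.Ioi (0 : ℝ), r ^ n * (ψ r * z r)| := by
    refine (le_abs_self _).trans ?_
    rw [abs_mul, hε, one_mul]
  linarith

/-- A real-valued form of the control by spherical means, for a bound `H` on them. -/
theorem norm_integral_radial_smul_le [Nonempty (Fin d)] {f : 𝓢(EuclideanSpace ℝ (Fin d), ℂ)}
    {H : ℝ → ℝ} (hH : ContinuousOn H (Set.Ioi 0)) (hH0 : ∀ r, 0 < r → 0 ≤ H r)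
    (hf : ∀ r, 0 < r → ∫⁻ θ, ‖f (r • (θ : EuclideanSpace ℝ (Fin d)))‖ₑ
      ∂(volume : Measure (EuclideanSpace ℝ (Fin d))).toSphere ≤ ENNReal.ofReal (H r))
    {r₀ : ℝ} (ψ : ContDiffBump r₀) (hψ : ψ.rOut < r₀) :
    ‖∫ x : EuclideanSpace ℝ (Fin d), ψ ‖x‖ • f x‖ ≤
      ∫ r in Set.Ioi (0 : ℝ), r ^ (d - 1) * (ψ r * H r) := by
  have hcont : Continuous fun r => r ^ (d - 1) * (ψ r * H r) :=
    (continuous_pow _).mul (continuous_bump_mul ψ hψ hH)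
  have hcomp : HasCompactSupport fun r => r ^ (d - 1) * (ψ r * H r) :=
    (ψ.hasCompactSupport.mul_right (f' := H)).mul_left
  have hnn : ∀ r ∈ Set.Ioi (0 : ℝ), 0 ≤ r ^ (d - 1) * (ψ r * H r) := by
    intro r hr
    have h1 : (0 : ℝ) < r := hr
    have h2 := hH0 r hr
    have h3 := ψ.nonneg (x := r)
    positivity
  have h0 : 0 ≤ ∫ r in Set.Ioi (0 : ℝ), r ^ (d - 1) * (ψ r * H r) :=
    setIntegral_nonneg measurableSet_Ioi hnn
  rw [← ENNReal.ofReal_le_ofReal_iff h0, ofReal_norm]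
  refine (enorm_integral_radial_smul_le f ψ.continuous fun r => ψ.nonneg).trans ?_
  rw [ofReal_integral_eq_lintegral_ofReal
    (hcont.integrable_of_hasCompactSupport hcomp).integrableOn
    ((ae_restrict_iff' measurableSet_Ioi).2 (ae_of_all _ hnn))]
  refine setLIntegral_mono' measurableSet_Ioi fun r hr => ?_
  have h1 : (0 : ℝ) < r := hr
  have h3 := ψ.nonneg (x := r)
  rw [← mul_assoc (r ^ (d - 1)), ENNReal.ofReal_mul (q := H r) (by positivity)]
  gcongr
  exact hf r hr

/-- A radial member of `Ḣ ^ s` with `1 ≤ s < d / 2`, continuous away from the origin, is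
`o(r ^ (s - d/2))` at the origin. -/
theorem MemHomSobolev.tendsto_rpow_mul {s : ℝ} (hs1 : 1 ≤ s) (hs : 2 * s < d)
    {Z : EuclideanSpace ℝ (Fin d) → ℝ} {z : ℝ → ℝ} (hZ : ∀ x, x ≠ 0 → Z x = z ‖x‖)
    (hz : ContinuousOn z (Set.Ioi 0)) (hmem : MemHomSobolev d s (fun x => (Z x : ℂ))) :
    Tendsto (fun r => r ^ (d / 2 - s) * z r) (𝓝[>] 0) (𝓝 0) := by
  have hd' : (2 : ℝ) < d := by linarith
  have hd : 2 < d := by exact_mod_cast hd'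
  have : Nonempty (Fin d) := ⟨⟨0, by omega⟩⟩
  obtain ⟨-, f, hcauchy, hlim⟩ := hmem
  obtain ⟨C, hC, hbound⟩ := exists_sphere_bound (d := d) hs1 hs
  set S : ℝ := (volume : Measure (EuclideanSpace ℝ (Fin d))).toSphere.real Set.univ with hS
  have hS0 : 0 < S := by
    rw [hS, Measure.real, ENNReal.toReal_pos_iff, pos_iff_ne_zero, Measure.measure_univ_ne_zero]
    exact ⟨Measure.toSphere_ne_zero _, measure_lt_top _ _⟩
  -- the uniform bound: `f m` contributes a bounded term, the tail of the sequence a small one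
  have hmain : ∀ η : ℝ, 0 < η → ∃ M : ℝ, 0 ≤ M ∧ ∀ r, 0 < r →
      |S * z r| ≤ S * M + C.toReal * r ^ (s - d / 2) * η := by
    intro η hη
    have hev := hcauchy.eventually_le_const (ENNReal.ofReal_pos.2 hη)
    obtain ⟨⟨a, b⟩, hab⟩ := eventually_atTop.1 hev
    set m := max a b with hm
    have htail : ∀ n, m ≤ n → homSobolevNorm d s (f n - f m) ≤ ENNReal.ofReal η := fun n hn =>
      hab (n, m) ⟨(le_max_left a b).trans hn, le_max_right a b⟩
    set M : ℝ := ‖(f m).toBoundedContinuousFunction‖ with hM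
    have hMb : ∀ x, ‖f m x‖ ≤ M := (f m).toBoundedContinuousFunction.norm_coe_le_norm
    set H : ℝ → ℝ := fun r => S * M + C.toReal * r ^ (s - d / 2) * η with hH
    have hHc : ContinuousOn H (Set.Ioi 0) := by
      have : ContinuousOn (fun r : ℝ => r ^ (s - d / 2)) (Set.Ioi 0) := fun r hr =>
        (Real.continuousAt_rpow_const r _ (Or.inl (ne_of_gt hr))).continuousWithinAt
      exact continuousOn_const.add ((continuousOn_const.mul this).mul continuousOn_const)
    have hH0 : ∀ r, 0 < r → 0 ≤ H r := fun r hr => by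
      have := C.toReal_nonneg
      have : 0 ≤ M := norm_nonneg _
      positivity
    have hsph : ∀ n, m ≤ n → ∀ r, 0 < r →
        ∫⁻ θ, ‖f n (r • (θ : EuclideanSpace ℝ (Fin d)))‖ₑ
          ∂(volume : Measure (EuclideanSpace ℝ (Fin d))).toSphere ≤ ENNReal.ofReal (H r) := by
      intro n hn r hr
      have hmeas : Measurable fun θ : Metric.sphere (0 : EuclideanSpace ℝ (Fin d)) 1 =>
          ‖f m (r • (θ : EuclideanSpace ℝ (Fin d)))‖ₑ :=
        ((f m).continuous.comp (by fun_prop)).enorm.measurable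
      calc _ ≤ ∫⁻ θ, (‖f m (r • (θ : EuclideanSpace ℝ (Fin d)))‖ₑ +
            ‖(f n - f m) (r • (θ : EuclideanSpace ℝ (Fin d)))‖ₑ)
            ∂(volume : Measure (EuclideanSpace ℝ (Fin d))).toSphere := by
            refine lintegral_mono fun θ => ?_
            have : f n (r • (θ : EuclideanSpace ℝ (Fin d))) =
                f m (r • (θ : EuclideanSpace ℝ (Fin d))) +
                (f n - f m) (r • (θ : EuclideanSpace ℝ (Fin d))) := by
              rw [sub_apply]; ring
            rw [this]
            exact enorm_add_le _ _
        _ = _ := lintegral_add_left hmeas _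
        _ ≤ ENNReal.ofReal (S * M) + ENNReal.ofReal (C.toReal * r ^ (s - d / 2) * η) := by
            refine add_le_add ?_ ((hbound _ r hr).trans ?_)
            · calc _ ≤ ∫⁻ _, ENNReal.ofReal M
                    ∂(volume : Measure (EuclideanSpace ℝ (Fin d))).toSphere :=
                    lintegral_mono fun θ => by
                      rw [← ofReal_norm]
                      exact ENNReal.ofReal_le_ofReal (hMb _)
                _ = _ := by
                    rw [lintegral_const, ENNReal.ofReal_mul hS0.le, hS,
                      ofReal_measureReal, mul_comm]
            · rw [ENNReal.ofReal_mul (by positivity), ENNReal.ofReal_mul (by positivity),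
                ENNReal.ofReal_toReal hC]
              gcongr
              exact htail n hn
        _ = ENNReal.ofReal (H r) := by
            rw [← ENNReal.ofReal_add (by positivity) (by positivity)]
    refine ⟨M, norm_nonneg _, abs_le_of_forall_bump (n := d - 1) (continuousOn_const.mul hz) hHc ?_⟩
    intro r₀ ψ hψ
    have hψ0 : (ψ : ℝ → ℝ) =ᶠ[𝓝 0] 0 := by
      have : ∀ᶠ r in 𝓝 (0 : ℝ), r < r₀ - ψ.rOut := gt_mem_nhds (by linarith)
      filter_upwards [this] with r hr
      apply ψ.zero_of_le_dist
      rw [Real.dist_eq, abs_sub_comm]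
      exact le_trans (by linarith) (le_abs_self _)
    have hcs : HasCompactSupport fun x : EuclideanSpace ℝ (Fin d) => ψ ‖x‖ := by
      refine HasCompactSupport.intro (isCompact_closedBall 0 (r₀ + ψ.rOut)) fun x hx => ?_
      rw [mem_closedBall_zero_iff, not_le] at hx
      apply ψ.zero_of_le_dist
      rw [Real.dist_eq]
      exact le_trans (by linarith) (le_abs_self _)
    have hl := (hlim (fun x => ψ ‖x‖)
      (contDiff_comp_norm_of_eventually_eq_zero ψ.contDiff hψ0) hcs).norm
    have hle := le_of_tendsto hl (eventually_atTop.2 ⟨m, fun n hn =>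
      norm_integral_radial_smul_le hHc hH0 (hsph n hn) ψ hψ⟩)
    have hu : ∫ x : EuclideanSpace ℝ (Fin d), ψ ‖x‖ • (Z x : ℂ) =
        ((∫ r in Set.Ioi (0 : ℝ), r ^ (d - 1) * (ψ r * (S * z r)) : ℝ) : ℂ) := by
      have h1 : ∫ x : EuclideanSpace ℝ (Fin d), ψ ‖x‖ • (Z x : ℂ) =
          ∫ x : EuclideanSpace ℝ (Fin d), ((ψ ‖x‖ * z ‖x‖ : ℝ) : ℂ) := by
        have h0 : ∀ᵐ x : EuclideanSpace ℝ (Fin d), x ≠ 0 := by simp [ae_iff]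
        refine integral_congr_ae ?_
        filter_upwards [h0] with x hx
        rw [hZ x hx]
        simp
      rw [h1, integral_complex_ofReal,
        integral_fun_norm_addHaar (volume : Measure (EuclideanSpace ℝ (Fin d)))
          (fun r => ψ r * z r), finrank_euclideanSpace_fin]
      congr 1
      have h2 : S = d * (volume : Measure (EuclideanSpace ℝ (Fin d))).real (Metric.ball 0 1) := by
        rw [hS, Measure.toSphere_real_apply_univ, finrank_euclideanSpace_fin]
      have h3 : ∀ r : ℝ, r ^ (d - 1) * (ψ r * (S * z r)) = S * (r ^ (d - 1) * (ψ r * z r)) :=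
        fun r => by ring
      simp_rw [h3]
      rw [integral_const_mul, h2, nsmul_eq_mul, smul_eq_mul, mul_assoc]
      rfl
    rw [hu, Complex.norm_real, Real.norm_eq_abs] at hle
    exact hle
  -- conclude, letting first `r → 0` and then the tail tend to zero
  set a : ℝ := d / 2 - s with ha
  have ha0 : 0 < a := by rw [ha]; linarith
  rw [Metric.tendsto_nhds]
  intro ε hε
  have hC0 : 0 ≤ C.toReal := C.toReal_nonneg
  set η : ℝ := ε * S / (2 * (C.toReal + 1)) with hη
  have hη0 : 0 < η := by positivity
  have hηC : C.toReal * η ≤ ε * S / 2 := by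
    rw [hη, mul_div_assoc', div_le_div_iff₀ (by positivity) (by positivity)]
    have : 0 < ε * S := by positivity
    nlinarith
  obtain ⟨M, hM0, hM⟩ := hmain η hη0
  have hsmall : Tendsto (fun r : ℝ => r ^ a * M) (𝓝[>] 0) (𝓝 0) := by
    have h1 : Tendsto (fun r : ℝ => r ^ a * M) (𝓝 0) (𝓝 (0 ^ a * M)) :=
      ((Real.continuousAt_rpow_const 0 a (Or.inr ha0.le)).tendsto).mul_const M
    rw [Real.zero_rpow ha0.ne', zero_mul] at h1
    exact h1.mono_left nhdsWithin_le_nhds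
  filter_upwards [hsmall.eventually_lt_const (half_pos hε), self_mem_nhdsWithin] with r hr hr0
  have hr0' : (0 : ℝ) < r := hr0
  have h1 := hM r hr0'
  rw [abs_mul, abs_of_pos hS0] at h1
  have hra : 0 < r ^ a := by positivity
  have h2 : r ^ a * r ^ (s - d / 2) = 1 := by
    rw [← Real.rpow_add hr0', ha]; simp
  rw [Real.dist_eq, sub_zero, abs_mul, abs_of_pos hra]
  have h3 : S * (r ^ a * |z r|) ≤ S * (r ^ a * M) + C.toReal * η := by
    calc S * (r ^ a * |z r|) = r ^ a * (S * |z r|) := by ring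
      _ ≤ r ^ a * (S * M + C.toReal * r ^ (s - d / 2) * η) := by gcongr
      _ = S * (r ^ a * M) + C.toReal * (r ^ a * r ^ (s - d / 2)) * η := by ring
      _ = _ := by rw [h2, mul_one]
  have h4 : S * (r ^ a * M) < S * (ε / 2) := by gcongr
  have h5 : S * (r ^ a * |z r|) < S * ε := by linarith
  exact lt_of_mul_lt_mul_left h5 hS0.le

end Radial

/-! ### Radial calculus and window integrals -/

section RadialCalculus

variable {E : Type*} [NormedAddCommGroup E] [InnerProductSpace ℝ E]

theorem hasFDerivAt_norm {x : E} (hx : x ≠ 0) :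
    HasFDerivAt (fun y : E => ‖y‖) (‖x‖⁻¹ • innerSL ℝ x) x := by
  have hx' : ‖x‖ ≠ 0 := norm_ne_zero_iff.2 hx
  have h1 := (hasStrictFDerivAt_norm_sq x).hasFDerivAt.sqrt (by positivity)
  simp only [Real.sqrt_sq (norm_nonneg _)] at h1
  convert h1 using 1
  ext y
  simp
  field_simp

theorem contDiffOn_two_of_hasDerivAt {z z₁ z₂ : ℝ → ℝ}
    (h1 : ∀ r, 0 < r → HasDerivAt z (z₁ r) r) (h2 : ∀ r, 0 < r → HasDerivAt z₁ (z₂ r) r)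
    (h3 : ContinuousOn z₂ (Set.Ioi 0)) : ContDiffOn ℝ 2 z (Set.Ioi 0) := by
  have hz₁ : ContDiffOn ℝ 1 z₁ (Set.Ioi 0) := by
    rw [show (1 : WithTop ℕ∞) = 0 + 1 by norm_num, contDiffOn_succ_iff_deriv_of_isOpen isOpen_Ioi]
    refine ⟨fun r hr => (h2 r hr).differentiableAt.differentiableWithinAt, by simp, ?_⟩
    rw [contDiffOn_zero]
    exact h3.congr fun r hr => (h2 r hr).deriv
  rw [show (2 : WithTop ℕ∞) = 1 + 1 by norm_num, contDiffOn_succ_iff_deriv_of_isOpen isOpen_Ioi]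
  exact ⟨fun r hr => (h1 r hr).differentiableAt.differentiableWithinAt, by simp,
    hz₁.congr fun r hr => (h1 r hr).deriv⟩

theorem contDiffOn_radial {n : WithTop ℕ∞} {Z : E → ℝ} {z : ℝ → ℝ}
    (hZ : ∀ x, x ≠ 0 → Z x = z ‖x‖) (hz : ContDiffOn ℝ n z (Set.Ioi 0)) :
    ContDiffOn ℝ n Z {0}ᶜ := by
  refine ContDiffOn.congr (f := fun x => z ‖x‖) ?_ fun x hx => hZ x hx
  intro x hx
  have h1 : ContDiffAt ℝ n z ‖x‖ := hz.contDiffAt (Ioi_mem_nhds (norm_pos_iff.2 hx))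
  exact (h1.comp x (contDiffAt_norm ℝ hx)).contDiffWithinAt

/-- The Laplacian of `z(‖x‖)` away from the origin is `z'' + (n-1)/r z'`. -/
theorem laplacian_radial [FiniteDimensional ℝ E] {Z : E → ℝ} {z z₁ z₂ : ℝ → ℝ}
    (hZ : ∀ x, x ≠ 0 → Z x = z ‖x‖) (h1 : ∀ r, 0 < r → HasDerivAt z (z₁ r) r)
    (h2 : ∀ r, 0 < r → HasDerivAt z₁ (z₂ r) r) {x : E} (hx : x ≠ 0) :
    Laplacian.laplacian Z x = z₂ ‖x‖ + (Module.finrank ℝ E - 1) / ‖x‖ * z₁ ‖x‖ := by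
  have hr : 0 < ‖x‖ := norm_pos_iff.2 hx
  -- near `x` the gradient of `Z` at `y` is `(z₁ ‖y‖ / ‖y‖) • y`
  have hgrad : ∀ y : E, y ≠ 0 → HasFDerivAt Z ((z₁ ‖y‖ * ‖y‖⁻¹) • innerSL ℝ y) y := by
    intro y hy
    have h3 := (h1 ‖y‖ (norm_pos_iff.2 hy)).comp_hasFDerivAt y (hasFDerivAt_norm hy)
    rw [smul_smul] at h3
    refine h3.congr_of_eventuallyEq ?_
    filter_upwards [isOpen_compl_singleton.mem_nhds hy] with w hw using hZ w hw
  have hev : fderiv ℝ Z =ᶠ[𝓝 x] fun y => (z₁ ‖y‖ * ‖y‖⁻¹) • innerSL ℝ y := by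
    filter_upwards [isOpen_compl_singleton.mem_nhds hx] with y hy using (hgrad y hy).fderiv
  have hcoef : HasFDerivAt (fun y : E => z₁ ‖y‖ * ‖y‖⁻¹)
      ((z₂ ‖x‖ * ‖x‖⁻¹ + z₁ ‖x‖ * (-(‖x‖ ^ 2)⁻¹)) • (‖x‖⁻¹ • innerSL ℝ x)) x :=
    HasDerivAt.comp_hasFDerivAt (h₂ := fun r => z₁ r * r⁻¹) x
      ((h2 ‖x‖ hr).mul (hasDerivAt_inv hr.ne')) (hasFDerivAt_norm hx)
  have hhess := hcoef.smul (innerSL ℝ : E →L[ℝ] E →L[ℝ] ℝ).hasFDerivAt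
  set b := stdOrthonormalBasis ℝ E
  have hterm : ∀ i, iteratedFDeriv ℝ 2 Z x ![b i, b i] =
      z₁ ‖x‖ * ‖x‖⁻¹ + (z₂ ‖x‖ * ‖x‖⁻¹ + z₁ ‖x‖ * (-(‖x‖ ^ 2)⁻¹)) * ‖x‖⁻¹ *
        (⟪x, b i⟫_ℝ * ⟪b i, x⟫_ℝ) := by
    intro i
    rw [iteratedFDeriv_two_apply, hev.fderiv_eq, HasFDerivAt.fderiv (f := fun y => (z₁ ‖y‖ * ‖y‖⁻¹) • innerSL ℝ y) hhess]
    have hin : ∀ u w : E, innerSL ℝ u w = ⟪u, w⟫_ℝ := fun _ _ => rfl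
    simp [real_inner_comm x (b i), hin]
    ring
  rw [InnerProductSpace.laplacian_eq_iteratedFDeriv_orthonormalBasis Z b]
  simp only [hterm]
  rw [Finset.sum_add_distrib, ← Finset.mul_sum (f := fun i => ⟪x, b i⟫_ℝ * ⟪b i, x⟫_ℝ), b.sum_inner_mul_inner, real_inner_self_eq_norm_sq,
    Finset.sum_const, Finset.card_univ, Fintype.card_fin, nsmul_eq_mul]
  field_simp
  ring

end RadialCalculus

section Windows

theorem tendsto_integral_window_of_tendsto_zero {g : ℝ → ℝ} (hg : Tendsto g atTop (𝓝 0)) :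
    Tendsto (fun T => ∫ t in T..(T + 1), g t) atTop (𝓝 0) := by
  rw [Metric.tendsto_atTop] at hg ⊢
  intro ε hε
  obtain ⟨T₀, hT₀⟩ := hg (ε / 2) (half_pos hε)
  refine ⟨T₀, fun T hT => ?_⟩
  have h := intervalIntegral.norm_integral_le_of_norm_le_const (a := T) (b := T + 1) (C := ε / 2)
    (f := g) (by
      intro t ht
      rw [Set.uIoc_of_le (by linarith)] at ht
      simpa using (hT₀ t (by linarith [ht.1])).le)
  rw [dist_zero_right]
  simp only [add_sub_cancel_left, abs_one, mul_one] at h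
  linarith

theorem tendsto_integral_window_of_integrable {g : ℝ → ℝ} (hg : Integrable g) :
    Tendsto (fun T => ∫ t in T..(T + 1), g t) atTop (𝓝 0) := by
  have h1 := intervalIntegral_tendsto_integral_Ioi 0 hg.integrableOn tendsto_id
  have h2 := intervalIntegral_tendsto_integral_Ioi 0 hg.integrableOn
    (tendsto_atTop_add_const_right atTop (1 : ℝ) tendsto_id)
  have h3 := h2.sub h1
  rw [sub_self] at h3
  refine h3.congr fun T => ?_
  simp only [id]
  rw [intervalIntegral.integral_interval_sub_left] <;> exact hg.intervalIntegrable

theorem pow_le_add_mul_pow {x η : ℝ} (hx : 0 ≤ x) (hη : 0 < η) (hη1 : η ≤ 1) {j q : ℕ}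
    (hj : 1 ≤ j) (hjq : j ≤ q) : x ^ j ≤ η + (η ^ q)⁻¹ * x ^ q := by
  rcases le_total x η with h | h
  · have h1 : x ^ j ≤ η := calc
      x ^ j ≤ η ^ j := by gcongr
      _ ≤ η ^ 1 := pow_le_pow_of_le_one hη.le hη1 hj
      _ = η := pow_one η
    have : 0 ≤ (η ^ q)⁻¹ * x ^ q := by positivity
    linarith
  · have h1 : 1 ≤ x / η := (one_le_div hη).2 h
    calc x ^ j = η ^ j * (x / η) ^ j := by rw [← mul_pow, mul_div_cancel₀ _ hη.ne']
      _ ≤ 1 * (x / η) ^ q := by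
          gcongr
          exact pow_le_one₀ hη.le hη1
      _ = (η ^ q)⁻¹ * x ^ q := by rw [one_mul, div_pow, div_eq_inv_mul]
      _ ≤ _ := by linarith

/-- Integrability of `|v| ^ q` with `q ≥ p` makes the means of `|v|` and `|v| ^ p` over unit windows
tend to zero, since both are at most `η + η ^ (-q) |v| ^ q` for every small `η`. -/
theorem tendsto_integral_window_of_integrable_pow {v : ℝ → ℝ} (hv : Continuous v) {p q : ℕ}
    (hp : 1 ≤ p) (hpq : p ≤ q) (hint : Integrable fun t => |v t| ^ q) :
    Tendsto (fun T => ∫ t in T..(T + 1), (|v t| + |v t| ^ p)) atTop (𝓝 0) := by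
  have hq := tendsto_integral_window_of_integrable hint
  rw [Metric.tendsto_nhds]
  intro ε hε
  set η : ℝ := min 1 (ε / 4) with hη
  have hη0 : 0 < η := lt_min one_pos (by positivity)
  have hη1 : η ≤ 1 := min_le_left _ _
  have hηε : η ≤ ε / 4 := min_le_right _ _
  have hlim := hq.const_mul (2 * (η ^ q)⁻¹)
  rw [mul_zero] at hlim
  filter_upwards [hlim.eventually_lt_const (half_pos hε)] with T hT
  have h0 : 0 ≤ ∫ t in T..(T + 1), (|v t| + |v t| ^ p) :=
    intervalIntegral.integral_nonneg (by linarith) fun t _ => by positivity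
  have h1 : ∫ t in T..(T + 1), (|v t| + |v t| ^ p) ≤
      ∫ t in T..(T + 1), (2 * η + 2 * (η ^ q)⁻¹ * |v t| ^ q) := by
    refine intervalIntegral.integral_mono_on (by linarith)
      (Continuous.intervalIntegrable (by fun_prop) _ _)
      (Continuous.intervalIntegrable (by fun_prop) _ _) fun t _ => ?_
    have h2 := pow_le_add_mul_pow (abs_nonneg (v t)) hη0 hη1 le_rfl (hp.trans hpq)
    have h3 := pow_le_add_mul_pow (abs_nonneg (v t)) hη0 hη1 hp hpq
    rw [pow_one] at h2
    linarith
  rw [intervalIntegral.integral_add (continuous_const.intervalIntegrable _ _)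
    (Continuous.intervalIntegrable (by fun_prop) _ _),
    intervalIntegral.integral_const_mul (2 * (η ^ q)⁻¹), intervalIntegral.integral_const, smul_eq_mul, add_sub_cancel_left, one_mul] at h1
  rw [dist_zero_right, Real.norm_of_nonneg h0]
  linarith

/-- If `a q = d`, the substitution `r = exp (-t)` turns the `L ^ q` norm of a radial function on
`ℝ ^ d` into that of `r ^ a z(r)` in the variable `t`. -/
theorem integrable_emden_pow {d q : ℕ} (hd : 1 ≤ d) {a : ℝ} (haq : a * q = d)
    {Z : EuclideanSpace ℝ (Fin d) → ℝ} {z : ℝ → ℝ} (hZ : ∀ x, x ≠ 0 → Z x = z ‖x‖)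
    (hmem : MemLp Z q volume) :
    Integrable fun t => |Real.exp (-(a * t)) * z (Real.exp (-t))| ^ q := by
  have : Nonempty (Fin d) := ⟨⟨0, by omega⟩⟩
  have h0 : ∀ᵐ x : EuclideanSpace ℝ (Fin d), x ≠ 0 := by simp [ae_iff]
  have h1 : Integrable (fun x : EuclideanSpace ℝ (Fin d) => |z ‖x‖| ^ q) := by
    have hq : q ≠ 0 := by
      rintro rfl
      simp only [Nat.cast_zero, mul_zero] at haq
      have : d = 0 := by exact_mod_cast haq.symm
      omega
    refine (hmem.integrable_norm_pow hq).congr ?_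
    filter_upwards [h0] with x hx
    rw [hZ x hx, Real.norm_eq_abs]
  rw [integrable_fun_norm_addHaar (volume : Measure (EuclideanSpace ℝ (Fin d)))
    (f := fun r => |z r| ^ q), finrank_euclideanSpace_fin] at h1
  have himg : (fun t : ℝ => Real.exp (-t)) '' Set.univ = Set.Ioi 0 := by
    rw [Set.image_univ]
    ext r
    constructor
    · rintro ⟨t, rfl⟩
      exact Real.exp_pos _
    · intro hr
      exact ⟨-Real.log r, by simp [Real.exp_log hr]⟩
  have hder : ∀ t ∈ (Set.univ : Set ℝ), HasDerivWithinAt (fun t : ℝ => Real.exp (-t))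
      (-Real.exp (-t)) Set.univ t := fun t _ => by
    have h := (hasDerivAt_id t).neg.exp
    simp only [mul_neg, mul_one] at h
    exact h.hasDerivWithinAt
  have hinj : Set.InjOn (fun t : ℝ => Real.exp (-t)) Set.univ := fun s _ t _ h => by
    simpa using h
  rw [← himg, integrableOn_image_iff_integrableOn_abs_deriv_smul MeasurableSet.univ hder hinj,
    integrableOn_univ] at h1
  refine h1.congr (ae_of_all _ fun t => ?_)
  simp only [smul_eq_mul, abs_neg, abs_mul, Real.abs_exp, mul_pow]
  rw [← mul_assoc]
  congr 1
  rw [← pow_succ', Nat.sub_add_cancel hd, ← Real.exp_nat_mul, ← Real.exp_nat_mul, ← haq]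
  congr 1
  ring

end Windows

/-! ### The singular solution -/

/-- In terms of `r = 1 / u`, the profile equations say that `z(r) = r ^ (-k) W(1/r)` solves
`z'' + (k+1)/r z' + z ^ p = 0`. -/
theorem hasDerivAt_inverted_profile {k p N : ℕ} (hk : 1 ≤ k) (hN : 1 ≤ N)
    (hkp : k * p = N + k + 2) {W Q : ℝ → ℝ}
    (hY : ∀ u, 0 < u → HasDerivAt (fun u => u ^ k * W u) (k * u ^ (k - 1) * Q u) u)
    (hQ : ∀ u, 0 < u → HasDerivAt Q (-(1 / k) * u ^ (N - 1) * W u ^ p) u) {r : ℝ} (hr : 0 < r) :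
    HasDerivAt (fun r => r⁻¹ ^ k * W r⁻¹) (-(k * r⁻¹ ^ (k + 1) * Q r⁻¹)) r ∧
    HasDerivAt (fun r => -(k * r⁻¹ ^ (k + 1) * Q r⁻¹))
      (k * (k + 1) * r⁻¹ ^ (k + 2) * Q r⁻¹ - (r⁻¹ ^ k * W r⁻¹) ^ p) r := by
  have hk0 : (0 : ℝ) < k := by exact_mod_cast hk
  have hu : 0 < r⁻¹ := inv_pos.2 hr
  have hinv : HasDerivAt (fun r : ℝ => r⁻¹) (-(r⁻¹ ^ 2)) r :=
    (hasDerivAt_inv hr.ne').congr_deriv (by rw [inv_pow])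
  constructor
  · refine ((hY _ hu).comp r hinv).congr_deriv ?_
    obtain ⟨n, rfl⟩ : ∃ n, k = n + 1 := ⟨k - 1, by omega⟩
    simp only [Nat.add_sub_cancel]
    ring
  · have h := ((hinv.pow (k + 1)).const_mul (k : ℝ)).mul ((hQ _ hu).comp r hinv)
    refine h.neg.congr_deriv ?_
    have hpow : (r⁻¹ ^ k) ^ p = r⁻¹ ^ (N + k + 2) := by rw [← pow_mul, hkp]
    rw [mul_pow, hpow]
    obtain ⟨n, rfl⟩ : ∃ n, N = n + 1 := ⟨N - 1, by omega⟩
    simp only [Function.comp_apply, Nat.add_sub_cancel, Pi.pow_apply]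
    push_cast
    generalize r⁻¹ = u
    field_simp
    ring

theorem proposition6p1 (d p : ℕ) (hd : 7 ≤ d) (hp : 3 ≤ p) (hp_odd : Odd p)
    (l : ℝ) (hl : l ≠ 0) :
    ∃ (Z : EuclideanSpace ℝ (Fin d) → ℝ) (z : ℝ → ℝ),
      (∀ x, x ≠ 0 → Z x = z ‖x‖) ∧
      ContDiffOn ℝ 2 Z {0}ᶜ ∧
      (∀ x, x ≠ 0 → Laplacian.laplacian Z x + |Z x| ^ (p - 1) * Z x = 0) ∧
      (fun r : ℝ => r ^ (d - 2) * z r - l) =O[atTop]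
        (fun r : ℝ => r ^ ((d : ℝ) - (p : ℝ) * ((d : ℝ) - 2))) ∧
      ¬ MemLp Z (ENNReal.ofReal ((d : ℝ) * ((p : ℝ) - 1) / 2)) volume ∧
      ¬ MemHomSobolev d ((d : ℝ) / 2 - 2 / ((p : ℝ) - 1)) (fun x => (Z x : ℂ)) := by
  obtain ⟨m, hm⟩ := hp_odd
  have hm1 : 1 ≤ m := by omega
  obtain ⟨k, hk⟩ : ∃ k, d = k + 2 := ⟨d - 2, by omega⟩
  have hk5 : 5 ≤ k := by omega
  have hk1 : 1 ≤ k := by omega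
  obtain ⟨N, hN⟩ : ∃ N, k * p = N + k + 2 := by
    refine ⟨k * p - k - 2, ?_⟩
    have : k * 3 ≤ k * p := Nat.mul_le_mul_left k hp
    omega
  have hN1 : 1 ≤ N := by
    have : k * 3 ≤ k * p := Nat.mul_le_mul_left k hp
    omega
  have hNr : (k : ℝ) * p = N + k + 2 := by exact_mod_cast hN
  have hdr : (d : ℝ) = k + 2 := by exact_mod_cast hk
  have hmr : (1 : ℝ) ≤ m := by exact_mod_cast hm1
  have hm0 : (0 : ℝ) < m := by linarith
  have hpr : (p : ℝ) = 2 * m + 1 := by exact_mod_cast hm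
  have hk5r : (5 : ℝ) ≤ k := by exact_mod_cast hk5
  set a : ℝ := 2 / ((p : ℝ) - 1) with ha
  have ham : a = 1 / m := by
    rw [ha, hpr]
    field_simp
    ring
  have ha0 : 0 < a := by rw [ham]; positivity
  have ha1 : a ≤ 1 := by rw [ham, div_le_one hm0]; exact hmr
  have hodd : Odd p := ⟨m, hm⟩
  obtain ⟨W, Q, hWc, hQc, hW0, hQ0, hY, hQ, C, hC⟩ := exists_profile k p N hk1 hodd hN1 hN l
  set z : ℝ → ℝ := fun r => r⁻¹ ^ k * W r⁻¹ with hz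
  set z₁ : ℝ → ℝ := fun r => -(k * r⁻¹ ^ (k + 1) * Q r⁻¹) with hz₁
  set z₂ : ℝ → ℝ := fun r => k * (k + 1) * r⁻¹ ^ (k + 2) * Q r⁻¹ - z r ^ p with hz₂
  have hzd : ∀ r, 0 < r → HasDerivAt z (z₁ r) r := fun r hr =>
    (hasDerivAt_inverted_profile hk1 hN1 hN hY hQ hr).1
  have hz₁d : ∀ r, 0 < r → HasDerivAt z₁ (z₂ r) r := fun r hr =>
    (hasDerivAt_inverted_profile hk1 hN1 hN hY hQ hr).2
  have hzc : ContinuousOn z (Set.Ioi 0) := fun r hr =>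
    (hzd r hr).continuousAt.continuousWithinAt
  have hz₂c : ContinuousOn z₂ (Set.Ioi 0) := by
    have hinv : ContinuousOn (fun r : ℝ => r⁻¹) (Set.Ioi 0) :=
      continuousOn_inv₀.mono fun r hr => (ne_of_gt hr : r ≠ 0)
    exact ((continuousOn_const.mul (hinv.pow _)).mul (hQc.comp_continuousOn hinv)).sub (hzc.pow p)
  set Z : EuclideanSpace ℝ (Fin d) → ℝ := fun x => z ‖x‖ with hZ
  have hZz : ∀ x, x ≠ 0 → Z x = z ‖x‖ := fun x _ => rfl
  -- Emden-Fowler variables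
  set v : ℝ → ℝ := fun τ => Real.exp ((k - a) * τ) * W (Real.exp τ) with hv
  set P : ℝ → ℝ := fun τ =>
    Real.exp ((k - a) * τ) * (k * Q (Real.exp τ) - a * W (Real.exp τ)) with hP
  have haN : (p - 1) * (k - a) = (N : ℝ) := by
    have : ((p : ℝ) - 1) * a = 2 := by
      rw [ha, hpr]
      field_simp
    linarith
  have hvd : ∀ τ, HasDerivAt v (P τ) τ := fun τ => (hasDerivAt_emden hk1 hN1 haN hY hQ τ).1
  have hPd : ∀ τ, HasDerivAt P ((k - 2 * a) * P τ + a * (k - a) * v τ - v τ ^ p) τ :=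
    fun τ => (hasDerivAt_emden hk1 hN1 haN hY hQ τ).2
  have hc : (0 : ℝ) < k - 2 * a := by linarith
  have hb : (0 : ℝ) ≤ a * (k - a) := mul_nonneg ha0.le (by linarith)
  have hvc : Continuous v := continuous_iff_continuousAt.2 fun τ => (hvd τ).continuousAt
  have hexp0 : Tendsto (fun τ => Real.exp ((k - a) * τ)) atBot (𝓝 0) :=
    Real.tendsto_exp_atBot.comp (tendsto_id.const_mul_atBot (by linarith))
  have hWlim : Tendsto (fun τ => W (Real.exp τ)) atBot (𝓝 l) := by
    have := (hWc.tendsto 0).comp Real.tendsto_exp_atBot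
    rwa [hW0] at this
  have hQlim : Tendsto (fun τ => Q (Real.exp τ)) atBot (𝓝 l) := by
    have := (hQc.tendsto 0).comp Real.tendsto_exp_atBot
    rwa [hQ0] at this
  have hcoef : Tendsto (fun τ => k * Q (Real.exp τ) - a * W (Real.exp τ)) atBot
      (𝓝 (k * l - a * l)) := (hQlim.const_mul _).sub (hWlim.const_mul _)
  have hne : ∃ τ, P τ ≠ 0 := by
    have h1 : (k : ℝ) * l - a * l ≠ 0 := by
      rw [← sub_mul]
      exact mul_ne_zero (by linarith) hl
    obtain ⟨τ, hτ⟩ := (hcoef.eventually_ne h1).exists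
    exact ⟨τ, mul_ne_zero (Real.exp_ne_zero _) hτ⟩
  obtain ⟨τ₀, hτ₀⟩ := exists_emdenEnergy_pos hc hvd hPd
    (by simpa using hexp0.mul hWlim) (by simpa using hexp0.mul hcoef) hne
  have hwin := not_tendsto_integral_window hodd hb hc.le hvd hPd hτ₀
  have hvz : ∀ τ, v τ = Real.exp (-(a * τ)) * z (Real.exp (-τ)) := by
    intro τ
    simp only [hv, hz]
    rw [← Real.exp_neg, neg_neg, ← mul_assoc, ← Real.exp_nat_mul, ← Real.exp_add]
    congr 2
    ring
  refine ⟨Z, z, hZz, contDiffOn_radial hZz (contDiffOn_two_of_hasDerivAt hzd hz₁d hz₂c),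
    fun x hx => ?_, ?_, fun hmem => hwin ?_, fun hmem => hwin ?_⟩
  · rw [laplacian_radial hZz hzd hz₁d hx, finrank_euclideanSpace_fin]
    have hr : 0 < ‖x‖ := norm_pos_iff.2 hx
    have heven : Even (p - 1) := ⟨m, by omega⟩
    have hpp : |Z x| ^ (p - 1) * Z x = z ‖x‖ ^ p := by
      rw [heven.pow_abs, ← pow_succ, Nat.sub_add_cancel (by omega)]
    rw [hpp]
    simp only [hz₂, hz₁, hdr]
    ring
  · refine IsBigO.of_bound C ?_
    filter_upwards [eventually_gt_atTop 0] with r hr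
    have hW : r ^ (d - 2) * z r = W r⁻¹ := by
      simp only [hz]
      rw [show d - 2 = k by omega, ← mul_assoc, ← mul_pow, mul_inv_cancel₀ hr.ne', one_pow, one_mul]
    have hexp : r ^ ((d : ℝ) - (p : ℝ) * ((d : ℝ) - 2)) = r⁻¹ ^ N := by
      rw [show (d : ℝ) - (p : ℝ) * ((d : ℝ) - 2) = -(N : ℝ) by rw [hdr]; linarith,
        Real.rpow_neg hr.le, Real.rpow_natCast, inv_pow]
    have hu : 0 < r⁻¹ := inv_pos.2 hr
    rw [hW, hexp, Real.norm_eq_abs, Real.norm_of_nonneg (by positivity)]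
    exact hC _ hu.le
  · have hq : ENNReal.ofReal ((d : ℝ) * ((p : ℝ) - 1) / 2) = ((d * m : ℕ) : ℝ≥0∞) := by
      rw [← ENNReal.ofReal_natCast]
      congr 1
      rw [hpr]
      push_cast
      ring
    rw [hq] at hmem
    have haq : a * ((d * m : ℕ) : ℝ) = d := by
      rw [ham]
      push_cast
      field_simp
    have hint := integrable_emden_pow (by omega) haq hZz hmem
    simp_rw [← hvz] at hint
    have hpq : p ≤ d * m := by
      have : 7 * m ≤ d * m := Nat.mul_le_mul_right m hd
      omega
    exact tendsto_integral_window_of_integrable_pow hvc (by omega) hpq hint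
  · have hlim := hmem.tendsto_rpow_mul (by rw [hdr]; linarith) (by linarith) hZz hzc
    rw [sub_sub_cancel] at hlim
    have htend : Tendsto v atTop (𝓝 0) := by
      have h1 : Tendsto (fun τ : ℝ => Real.exp (-τ)) atTop (𝓝[>] 0) :=
        Real.tendsto_exp_atBot_nhdsGT.comp tendsto_neg_atTop_atBot
      refine (hlim.comp h1).congr fun τ => ?_
      rw [hvz, Function.comp_apply, ← Real.exp_mul]
      congr 2
      ring
    apply tendsto_integral_window_of_tendsto_zero
    have h := htend.abs.add (htend.abs.pow p)
    simpa [show p ≠ 0 by omega] using h
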